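/- Let $k$ be a field. For a finite group $G$ and a field extension $F/k$, a $G$-torsor over $F$ is the same as a Galois $G$-algebra over $F$: a nonzero commutative $F$-algebra $A$ with an action of $G$ by $F$-algebra automorphisms such that $A\otimes_F A\to\prod_{g\in G}A$, $a\otimes b\mapsto (a\,g(b))_g$, is bijective. For a prime $l$, let $\operatorname{ed}_k(A,l)$ be the minimum of $\operatorname{trdeg}_k(K)$ over all finite field extensions $E/F$ with $l\nmid [E:F]$ and all intermediate fields $k\subseteq K\subseteq E$ such that $E\otimes_F A\cong E\otimes_K B$ as $G$-algebras over $E$ for some Galois $G$-algebra $B$ over $K$. The essential $l$-dimension $\operatorname{ed}_k(G,l)$ is the supremum of $\operatorname{ed}_k(A,l)$ over all field extensions $F/k$ and all Galois $G$-algebras $A$ over $F$. Theorem. Let $p$ be a prime, $q=p^r$ with $r\ge 1$, and let $l$ be a prime with $l\neq 2$ and $l\neq p$. Let $k$ be a field with $\operatorname{char} k\neq l$, let $n\ge 0$ be an integer, and let $d$ be the smallest positive integer such that $l\mid q^d-1$. Let $Sp(2n,q)$ be the symplectic group of $2n\times 2n$ matrices over $\mathbb{F}_q$ and $PSp(2n,q)$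 its quotient by its centre. Then $$\operatorname{ed}_k(PSp(2n,q),l)=\operatorname{ed}_k(Sp(2n,q),l)=\begin{cases}\operatorname{ed}_k(GL_{2n}(\mathbb{F}_q),l), & d \text{ even},\\ \operatorname{ed}_k(GL_n(\mathbb{F}_q),l), & d\text{ odd}.\end{cases}$$ -/

import Mathlib

open scoped TensorProduct

universe u v

/-- The `F`-algebra map `A ⊗ A → ∏_{g ∈ G} A`, `a ⊗ b ↦ (a * g(b))_g`, attached to an action of `G`
on the commutative `F`-algebra `A`. On spectra it is the map `G × X → X ×_F X`,
`(g, x) ↦ (x, x g)`, for `X = Spec A` with the induced right action. -/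
noncomputable def galoisMap {G : Type v} [Group G] {F : Type u} [Field F] {A : Type u} [CommRing A]
    [Algebra F A] (ρ : G →* (A ≃ₐ[F] A)) : A ⊗[F] A →ₐ[F] (G → A) :=
  Algebra.TensorProduct.productMap
    (AlgHom.pi (fun _ : G => AlgHom.id F A))
    (AlgHom.pi (fun g : G => (ρ g : A →ₐ[F] A)))

/-- For a finite group `G`, a `G`-torsor over `Spec F`, given as a Galois `G`-algebra over `F`:
a nonzero commutative `F`-algebra with an action of `G` by `F`-algebra automorphisms such that
`A ⊗ A → ∏_{g ∈ G} A` is bijective. (Such an `A` is automatically étale of dimension `|G|`.) -/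
structure GaloisAlg (G : Type v) [Group G] (F : Type u) [Field F] where
  carrier : Type u
  [commRing : CommRing carrier]
  [algebra : Algebra F carrier]
  act : G →* (carrier ≃ₐ[F] carrier)
  nontrivial : Nontrivial carrier
  bijective : Function.Bijective (galoisMap act)

attribute [instance] GaloisAlg.commRing GaloisAlg.algebra

/-- The action of `g : G` on the base change `E ⊗_F A` of a Galois `G`-algebra `A` over `F`. -/
noncomputable def GaloisAlg.baseChangeAct {G : Type v} [Group G] {F : Type u} [Field F]
    (A : GaloisAlg G F) (E : Type u) [Field E] [Algebra F E] (g : G) :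
    E ⊗[F] A.carrier ≃ₐ[E] E ⊗[F] A.carrier :=
  Algebra.TensorProduct.congr (AlgEquiv.refl : E ≃ₐ[E] E) (A.act g)

/-- Galois `G`-algebras `A` over `F` and `B` over `K` become isomorphic, as `G`-algebras,
over the common extension field `E`. -/
def GaloisAlg.IsoOver {G : Type v} [Group G] {F K : Type u} [Field F] [Field K]
    (A : GaloisAlg G F) (B : GaloisAlg G K) (E : Type u) [Field E] [Algebra F E] [Algebra K E] :
    Prop :=
  ∃ e : E ⊗[F] A.carrier ≃ₐ[E] E ⊗[K] B.carrier,
    ∀ (g : G) (x : E ⊗[F] A.carrier),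
      e (A.baseChangeAct E g x) = B.baseChangeAct E g (e x)

/-- The essential `l`-dimension over `k` of a `G`-torsor `A` over `F`: the minimum of
`trdeg_k K` over all finite extensions `E / F` of degree prime to `l` and all intermediate fields
`k ⊆ K ⊆ E` such that `A` becomes, over `E`, isomorphic to a torsor coming from `K`. -/
noncomputable def GaloisAlg.essDimAt (k : Type u) [Field k] {G : Type v} [Group G]
    {F : Type u} [Field F] [Algebra k F] (A : GaloisAlg G F) (l : ℕ) : ℕ∞ :=
  sInf {m : ℕ∞ | ∃ (E : Type u) (_ : Field E) (_ : Algebra k E) (_ : Algebra F E)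
    (_ : IsScalarTower k F E) (_ : FiniteDimensional F E), ¬ l ∣ Module.finrank F E ∧
      ∃ (K : IntermediateField k E) (B : GaloisAlg G K),
        A.IsoOver B E ∧ m = Cardinal.toENat (Algebra.trdeg k K)}

/-- The essential `l`-dimension `ed_k(G, l)` of a finite group `G` over the field `k`: the
supremum of the essential `l`-dimensions of all `G`-torsors over all field extensions `F / k`. -/
noncomputable def essDimAt (k : Type u) [Field k] (G : Type v) [Group G] (l : ℕ) : ℕ∞ :=
  sSup {m : ℕ∞ | ∃ (F : Type u) (_ : Field F) (_ : Algebra k F) (A : GaloisAlg G F),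
    m = A.essDimAt k l}

/-- The symplectic group `Sp(2n, K)`. -/
abbrev Sp (n : ℕ) (K : Type v) [Field K] : Type v :=
  Matrix.symplecticGroup (Fin n) K

/-- The projective symplectic group `PSp(2n, K)`, the quotient of `Sp(2n, K)` by its centre. -/
abbrev PSp (n : ℕ) (K : Type v) [Field K] : Type v :=
  Sp n K ⧸ Subgroup.center (Sp n K)

/-! The essential `l`-dimension of a finite group is unchanged on passing to a subgroup of index
prime to `l` (`essDimAt_eq_of_injective`), so the theorem reduces to comparing group orders.

For any subgroup `H` of `G`, `ed H ≤ ed G`: induce an `H`-torsor to `G`, descend the result, and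
evaluate at `1`. If the index is prime to `l`, then `ed G ≤ ed H`: the `H`-invariants of a
`G`-torsor `A` have dimension `[G : H]`, so some residue field has degree prime to `l`, and over it
`A` is induced from an `H`-torsor. Descent is carried by dual systems `∑ u_i g(v_i) = δ_{g,1}`,
which survive every equivariant ring homomorphism.

The centre of `Sp` is killed by `2`, so for odd `l` a Sylow `l`-subgroup of `Sp` embeds in `PSp`
with index prime to `l`. Counting hyperbolic systems gives `|Sp(2n,q)|` as a power of `q` times `∏
(q^(2i) - 1)`. The prime-to-`q` part of `[GL_{2n} : Sp]` is thus a product of factors `q^(odd) - 1`,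
prime to `l` when `d` is even; that of `[Sp : GL_n]` is a product of factors `q^i + 1`, prime to `l`
when `d` and `l` are odd. -/

/-! ### Dual systems and traces -/

section DualSystem

variable {G : Type*} [Group G] {F : Type*} [CommRing F] {A : Type*} [CommRing A] [Algebra F A]

open Classical in
/-- `u` and `v` form a dual system for the action `ρ`: `∑ i, u i * g (v i) = δ_{g, 1}`. -/
def IsDualSystem (ρ : G →* (A ≃ₐ[F] A)) {ι : Type*} [Fintype ι] (u v : ι → A) : Prop :=
  ∀ g : G, ∑ i, u i * ρ g (v i) = if g = 1 then 1 else 0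

/-- An elementwise form of the definition of a Galois algebra: the invariants are the scalars, and
there is a dual system. -/
structure IsGaloisAction (ρ : G →* (A ≃ₐ[F] A)) : Prop where
  nontrivial : Nontrivial A
  fixed : ∀ a, (∀ g, ρ g a = a) → ∃ c, algebraMap F A c = a
  dual : ∃ (ι : Type) (_ : Fintype ι) (u v : ι → A), IsDualSystem ρ u v

theorem galoisMap_tmul {G : Type v} [Group G] {F : Type u} [Field F] {A : Type u} [CommRing A]
    [Algebra F A] (ρ : G →* (A ≃ₐ[F] A)) (a b : A) (g : G) :
    galoisMap ρ (a ⊗ₜ b) g = a * ρ g b := by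
  simp [galoisMap]

/-- Expansion of an element in a dual system. -/
theorem IsDualSystem.sum_trace_mul [Fintype G] {ρ : G →* (A ≃ₐ[F] A)} {ι : Type*} [Fintype ι]
    {u v : ι → A} (h : IsDualSystem ρ u v) (a : A) :
    ∑ i, (∑ g, ρ g (a * u i)) * v i = a := by
  classical
  have key : ∀ g : G, ∑ i, ρ g (a * u i) * v i = if g = 1 then a else 0 := by
    intro g
    have h1 : ∀ i, ρ g (a * u i) * v i = ρ g (a * (u i * ρ g⁻¹ (v i))) := by
      intro i
      have : ρ g (ρ g⁻¹ (v i)) = v i := by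
        rw [← AlgEquiv.mul_apply, ← map_mul]; simp
      rw [map_mul, map_mul, map_mul, this, mul_assoc]
    simp_rw [h1]
    rw [← map_sum, ← Finset.mul_sum, h g⁻¹]
    by_cases hg : g = 1 <;> simp [hg]
  simp_rw [Finset.sum_mul]
  rw [Finset.sum_comm, Finset.sum_congr rfl fun g _ => key g]
  simp

theorem trace_invariant [Fintype G] (ρ : G →* (A ≃ₐ[F] A)) (a : A) (x : G) :
    ρ x (∑ g, ρ g a) = ∑ g, ρ g a := by
  rw [map_sum]
  have : ∀ g, ρ x (ρ g a) = ρ (x * g) a := fun g => by rw [map_mul, AlgEquiv.mul_apply]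
  simp_rw [this]
  exact Equiv.sum_comp (Equiv.mulLeft x) (fun g => ρ g a)

theorem IsGaloisAction.exists_trace [Fintype G] {ρ : G →* (A ≃ₐ[F] A)} (h : IsGaloisAction ρ)
    (a : A) : ∃ c, algebraMap F A c = ∑ g, ρ g a :=
  h.fixed _ (trace_invariant ρ a)

/-- An element of trace one. -/
theorem IsGaloisAction.exists_trace_eq_one [Fintype G] {F : Type*} [Field F] [Algebra F A]
    {ρ : G →* (A ≃ₐ[F] A)}
    (h : IsGaloisAction ρ) : ∃ a, ∑ g, ρ g a = 1 := by
  have := h.nontrivial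
  obtain ⟨ι, _, u, v, huv⟩ := h.dual
  have h1 := huv.sum_trace_mul 1
  obtain ⟨i, hi⟩ : ∃ i, ∑ g, ρ g (u i) ≠ 0 := by
    by_contra! hcon
    simp [hcon] at h1
  obtain ⟨c, hc⟩ := h.exists_trace (u i)
  have hc0 : c ≠ 0 := by rintro rfl; exact hi (by rw [← hc, map_zero])
  refine ⟨c⁻¹ • u i, ?_⟩
  simp_rw [map_smul]
  rw [← Finset.smul_sum, ← hc, Algebra.smul_def, ← map_mul, inv_mul_cancel₀ hc0, map_one]

/-- The expansion formula shows that the `v i` span: its coefficients are traces, hence scalars. -/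
theorem IsGaloisAction.finite [Finite G] {ρ : G →* (A ≃ₐ[F] A)} (h : IsGaloisAction ρ) :
    Module.Finite F A := by
  have := Fintype.ofFinite G
  obtain ⟨ι, _, u, v, huv⟩ := h.dual
  refine Module.Finite.of_surjective (Fintype.linearCombination F v) fun a => ?_
  choose c hc using fun i => h.exists_trace (a * u i)
  refine ⟨c, ?_⟩
  conv_rhs => rw [← huv.sum_trace_mul a]
  simp [Fintype.linearCombination_apply, Algebra.smul_def, hc]

/-- The trace of a nilpotent is a nilpotent scalar, hence zero in a field, so all coefficients in
its expansion vanish. -/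
theorem IsGaloisAction.isReduced [Finite G] {F : Type*} [Field F] [Algebra F A]
    {ρ : G →* (A ≃ₐ[F] A)} (h : IsGaloisAction ρ) : IsReduced A := by
  have := Fintype.ofFinite G
  have := h.nontrivial
  obtain ⟨ι, _, u, v, huv⟩ := h.dual
  refine ⟨fun a ha => ?_⟩
  rw [← huv.sum_trace_mul a]
  refine Finset.sum_eq_zero fun i _ => ?_
  obtain ⟨c, hc⟩ := h.exists_trace (a * u i)
  have hn : IsNilpotent (∑ g, ρ g (a * u i)) :=
    isNilpotent_sum fun g _ => ((Commute.all _ _).isNilpotent_mul_right ha).map (ρ g)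
  rw [← hc] at hn ⊢
  have : IsNilpotent c := by
    rwa [IsNilpotent.map_iff (algebraMap F A).injective] at hn
  rw [this.eq_zero]; simp

/-- Only equivariance matters, not linearity over a common base, so torsors over different fields
can be compared. -/
theorem IsDualSystem.map {K B : Type*} [CommRing K] [CommRing B] [Algebra K B]
    {ρ : G →* (B ≃ₐ[K] B)} {σ : G →* (A ≃ₐ[F] A)} (f : B →+* A)
    (hf : ∀ g b, f (ρ g b) = σ g (f b)) {ι : Type*} [Fintype ι] {u v : ι → B}
    (h : IsDualSystem ρ u v) : IsDualSystem σ (f ∘ u) (f ∘ v) := by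
  intro g
  have := congrArg f (h g)
  rw [map_sum] at this
  simp only [map_mul, hf, apply_ite f, map_one, map_zero] at this
  exact this

end DualSystem

/-! ### Galois algebras in terms of dual systems -/

/-- The elementwise description of Galois algebras. -/
theorem isGaloisAction_of_bijective {G : Type v} [Group G] {F : Type u} [Field F]
    {A : Type u} [CommRing A] [Algebra F A] [Nontrivial A] {ρ : G →* (A ≃ₐ[F] A)}
    (h : Function.Bijective (galoisMap ρ)) : IsGaloisAction ρ := by
  classical
  refine ⟨inferInstance, fun a ha => ?_, ?_⟩
  · have h1 : (1 : A) ⊗ₜ[F] a = a ⊗ₜ[F] 1 := by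
      apply h.1
      ext g
      simp [galoisMap_tmul, ha]
    -- A functional `φ` with `φ 1 ≠ 0`, applied to the left factors of `1 ⊗ a = a ⊗ 1`, gives `φ 1 •
    -- a = φ a • 1`.
    have h1' : (1 : A) ∉ (⊥ : Submodule F A) := by simp
    obtain ⟨φ, hφ, -⟩ := Submodule.exists_le_ker_of_notMem h1'
    have h2 := congrArg (TensorProduct.lift ((LinearMap.lsmul F A).comp φ)) h1
    simp at h2
    refine ⟨(φ 1)⁻¹ * φ a, ?_⟩
    rw [map_mul, Algebra.algebraMap_eq_smul_one (φ a), ← h2, ← Algebra.smul_def,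
      inv_smul_smul₀ hφ]
  -- A tensor mapping to the indicator of the identity is exactly a dual system.
  · obtain ⟨t, ht⟩ := h.2 (Pi.single 1 1)
    obtain ⟨n, u, v, rfl⟩ := TensorProduct.exists_sum_tmul_eq t
    refine ⟨Fin n, inferInstance, u, v, fun g => ?_⟩
    have := congrFun ht g
    rw [map_sum, Finset.sum_apply] at this
    simp only [galoisMap_tmul] at this
    rw [this, Pi.single_apply]

theorem IsGaloisAction.bijective {G : Type v} [Group G] [Finite G] {F : Type u} [Field F]
    {A : Type u} [CommRing A] [Algebra F A] {ρ : G →* (A ≃ₐ[F] A)}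
    (h : IsGaloisAction ρ) : Function.Bijective (galoisMap ρ) := by
  classical
  have := Fintype.ofFinite G
  obtain ⟨ι, _, u, v, huv⟩ := h.dual
  constructor
  · rw [injective_iff_map_eq_zero]
    intro t ht
    obtain ⟨n, a, b, rfl⟩ := TensorProduct.exists_sum_tmul_eq t
    have ht' : ∀ g, ∑ j, a j * ρ g (b j) = 0 := by
      intro g
      have := congrFun ht g
      rw [map_sum, Finset.sum_apply] at this
      simp only [galoisMap_tmul] at this
      exact this
    choose c hc using fun j i => h.exists_trace (b j * u i)
    -- The trace coefficients lie in `F`, so they cross the tensor sign; the left factor of `v i`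
    -- becomes `∑ g, (∑ j, a j * g (b j)) * g (u i) = 0`.
    have hb : ∀ j, b j = ∑ i, c j i • v i := by
      intro j
      conv_lhs => rw [← huv.sum_trace_mul (b j)]
      simp [Algebra.smul_def, hc]
    have h1 : ∑ j, a j ⊗ₜ[F] b j = ∑ i, (∑ j, c j i • a j) ⊗ₜ[F] v i := by
      simp_rw [TensorProduct.sum_tmul]
      rw [Finset.sum_comm]
      refine Finset.sum_congr rfl fun j _ => ?_
      conv_lhs => rw [hb j, TensorProduct.tmul_sum]
      simp [TensorProduct.smul_tmul]
    rw [h1]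
    refine Finset.sum_eq_zero fun i _ => ?_
    have h2 : ∑ j, c j i • a j = 0 := by
      simp_rw [Algebra.smul_def, hc, Finset.sum_mul]
      rw [Finset.sum_comm]
      refine Finset.sum_eq_zero fun g _ => ?_
      have : ∀ j, ρ g (b j * u i) * a j = (a j * ρ g (b j)) * ρ g (u i) := by
        intro j; rw [map_mul]; ring
      simp_rw [this]
      rw [← Finset.sum_mul, ht', zero_mul]
    rw [h2, TensorProduct.zero_tmul]
  · intro f
    -- For fixed `x`, the tensor `∑ i, x (u i) ⊗ v i` maps to the indicator of `x`.
    refine ⟨∑ x : G, ∑ i, (f x * ρ x (u i)) ⊗ₜ v i, ?_⟩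
    ext g
    simp only [map_sum, Finset.sum_apply, galoisMap_tmul]
    have : ∀ x i, f x * ρ x (u i) * ρ g (v i) = f x * ρ x (u i * ρ (x⁻¹ * g) (v i)) := by
      intro x i
      rw [map_mul (ρ x), ← AlgEquiv.mul_apply (ρ x), ← map_mul, mul_inv_cancel_left, mul_assoc]
    simp_rw [this, ← Finset.mul_sum, ← map_sum, huv _]
    rw [Finset.sum_eq_single g]
    · simp
    · intro x _ hx
      rw [if_neg (by rwa [inv_mul_eq_one]), map_zero, mul_zero]
    · simp

namespace GaloisAlg

variable {G : Type v} [Group G] {F : Type u} [Field F]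

theorem isGaloisAction (A : GaloisAlg G F) : IsGaloisAction A.act :=
  haveI := A.nontrivial
  isGaloisAction_of_bijective A.bijective

/-- The Galois algebra given by an action with a dual system. -/
def ofAction [Finite G] {A : Type u} [CommRing A] [Algebra F A] (ρ : G →* (A ≃ₐ[F] A))
    (h : IsGaloisAction ρ) : GaloisAlg G F where
  carrier := A
  act := ρ
  nontrivial := h.nontrivial
  bijective := h.bijective

end GaloisAlg

/-! ### Base change and morphisms of torsors -/

/-- The base change of an action by algebra automorphisms. -/
noncomputable def baseChangeHom {G : Type*} [Group G] {F A : Type*} [CommRing F] [CommRing A]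
    [Algebra F A] (ρ : G →* (A ≃ₐ[F] A)) (E : Type*) [Field E] [Algebra F E] :
    G →* (E ⊗[F] A ≃ₐ[E] E ⊗[F] A) where
  toFun g := Algebra.TensorProduct.congr (AlgEquiv.refl : E ≃ₐ[E] E) (ρ g)
  map_one' := by ext x; induction x <;> simp_all
  map_mul' g h := by ext x; induction x <;> simp_all

theorem baseChangeHom_tmul {G : Type*} [Group G] {F A : Type*} [CommRing F] [CommRing A]
    [Algebra F A] (ρ : G →* (A ≃ₐ[F] A)) (E : Type*) [Field E] [Algebra F E] (g : G) (x : E)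
    (a : A) : baseChangeHom ρ E g (x ⊗ₜ a) = x ⊗ₜ ρ g a := rfl

/-- A morphism of torsors over an extension of fields identifies the target with a base change. -/
theorem IsGaloisAction.lift_bijective {G : Type*} [Group G] [Finite G] {K E B C : Type*} [Field K]
    [Field E] [Algebra K E] [CommRing B] [Algebra K B] [CommRing C] [Algebra E C] [Algebra K C]
    [IsScalarTower K E C] {ρ : G →* (B ≃ₐ[K] B)} {σ : G →* (C ≃ₐ[E] C)} (hρ : IsGaloisAction ρ)
    (hσ : IsGaloisAction σ) (f : B →ₐ[K] C) (hf : ∀ g b, f (ρ g b) = σ g (f b)) :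
    Function.Bijective (Algebra.TensorProduct.lift (Algebra.ofId E C) f
      (fun _ _ => Commute.all _ _)) := by
  have := Fintype.ofFinite G
  have := hσ.nontrivial
  obtain ⟨ι, _, u, v, huv⟩ := hρ.dual
  have huv' := huv.map (σ := σ) (f : B →+* C) hf
  constructor
  · rw [injective_iff_map_eq_zero]
    intro t ht
    obtain ⟨n, a, b, rfl⟩ := TensorProduct.exists_sum_tmul_eq t
    have ht' : ∑ j, algebraMap E C (a j) * f (b j) = 0 := by
      simpa [map_sum, Algebra.ofId_apply] using ht
    choose c hc using fun j i => hρ.exists_trace (b j * u i)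
    have hb : ∀ j, b j = ∑ i, c j i • v i := by
      intro j
      conv_lhs => rw [← huv.sum_trace_mul (b j)]
      simp [Algebra.smul_def, hc]
    have h1 : ∑ j, a j ⊗ₜ[K] b j = ∑ i, (∑ j, c j i • a j) ⊗ₜ[K] v i := by
      simp_rw [TensorProduct.sum_tmul]
      rw [Finset.sum_comm]
      refine Finset.sum_congr rfl fun j _ => ?_
      conv_lhs => rw [hb j, TensorProduct.tmul_sum]
      simp [TensorProduct.smul_tmul]
    rw [h1]
    refine Finset.sum_eq_zero fun i _ => ?_
    have h2 : ∑ j, c j i • a j = 0 := by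
      apply (algebraMap E C).injective
      have hcj : ∀ j, algebraMap E C (algebraMap K E (c j i)) =
          ∑ g, σ g (f (b j) * f (u i)) := by
        intro j
        rw [← IsScalarTower.algebraMap_apply K E C, ← f.commutes, hc, map_sum]
        simp [hf]
      simp_rw [map_sum, Algebra.smul_def, map_mul, hcj, Finset.sum_mul]
      rw [Finset.sum_comm, map_zero]
      refine Finset.sum_eq_zero fun g _ => ?_
      have : ∀ j, σ g (f (b j) * f (u i)) * algebraMap E C (a j) =
          σ g ((algebraMap E C (a j) * f (b j)) * f (u i)) := by
        intro j; rw [map_mul (σ g), map_mul (σ g), map_mul (σ g), (σ g).commutes]; ring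
      simp_rw [this]
      rw [← map_sum, ← Finset.sum_mul, ht', zero_mul, map_zero]
    rw [h2, TensorProduct.zero_tmul]
  · intro x
    choose c hc using fun i => hσ.exists_trace (x * f (u i))
    refine ⟨∑ i, c i ⊗ₜ v i, ?_⟩
    conv_rhs => rw [← huv'.sum_trace_mul x]
    simp [Algebra.ofId_apply, hc]

theorem IsGaloisAction.exists_algEquiv {G : Type*} [Group G] [Finite G] {K E B C : Type*} [Field K]
    [Field E] [Algebra K E] [CommRing B] [Algebra K B] [CommRing C] [Algebra E C]
    {ρ : G →* (B ≃ₐ[K] B)} {σ : G →* (C ≃ₐ[E] C)} (hρ : IsGaloisAction ρ)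
    (hσ : IsGaloisAction σ) (f : B →+* C)
    (hf : ∀ c, f (algebraMap K B c) = algebraMap E C (algebraMap K E c))
    (hfg : ∀ g b, f (ρ g b) = σ g (f b)) :
    ∃ e : E ⊗[K] B ≃ₐ[E] C, ∀ g x, σ g (e x) = e (baseChangeHom ρ E g x) := by
  let _ : Algebra K C := ((algebraMap E C).comp (algebraMap K E)).toAlgebra
  have : IsScalarTower K E C := IsScalarTower.of_algebraMap_eq fun _ => rfl
  let f' : B →ₐ[K] C := { f with commutes' := hf }
  refine ⟨AlgEquiv.ofBijective _ (hρ.lift_bijective hσ f' hfg), fun g x => ?_⟩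
  induction x with
  | zero => simp
  | tmul e b =>
    simp only [baseChangeHom_tmul, AlgEquiv.coe_ofBijective, Algebra.TensorProduct.lift_tmul,
      Algebra.ofId_apply, map_mul, AlgEquiv.commutes]
    congr 1
    exact (hfg g b).symm
  | add y z hy hz => simp only [map_add, hy, hz]

/-- Galois algebras over a commutative ring with an element of trace one are preserved by base
change to a field. -/
theorem IsGaloisAction.baseChange_of_trace_eq_one {G : Type*} [Group G] [Fintype G] {R A : Type*}
    [CommRing R] [CommRing A] [Algebra R A] {ρ : G →* (A ≃ₐ[R] A)} (h : IsGaloisAction ρ)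
    (hinj : Function.Injective (algebraMap R A)) {a : A} (ha : ∑ g, ρ g a = 1) (E : Type*)
    [Field E] [Algebra R E] : IsGaloisAction (baseChangeHom ρ E) := by
  refine ⟨?_, fun x hx => ?_, ?_⟩
  -- The map `b ↦ tr (b a)` is an `R`-linear retraction of `R → A`; tensored with `E` it shows that
  -- `1 ≠ 0` in `E ⊗ A`.
  · choose t ht using fun b => h.exists_trace (b * a)
    let τ : A →ₗ[R] R :=
      { toFun := t
        map_add' := fun x y => hinj <| by
          rw [map_add, ht, ht, ht, ← Finset.sum_add_distrib]; simp [add_mul]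
        map_smul' := fun c x => hinj <| by
          rw [RingHom.id_apply, smul_eq_mul, map_mul, ht, ht, Finset.mul_sum]
          simp [mul_assoc, Algebra.smul_def] }
    have h1 : τ 1 = 1 := hinj <| by
      change algebraMap R A (t 1) = _
      rw [ht, one_mul, ha, map_one]
    refine ⟨1, 0, fun h0 => ?_⟩
    have h2 := congrArg (TensorProduct.rid R E ∘ τ.lTensor E) h0
    simp [Algebra.TensorProduct.one_def, h1] at h2
  -- An invariant `x` is the trace of `x * (1 ⊗ a)`, and every trace in `E ⊗ A` is a scalar, as one
  -- sees on pure tensors.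
  · have h1 : x = ∑ g, baseChangeHom ρ E g (x * 1 ⊗ₜ a) := by
      simp_rw [map_mul, hx, baseChangeHom_tmul, ← Finset.mul_sum, ← TensorProduct.tmul_sum, ha]
      exact (mul_one x).symm
    have h2 : ∀ y : E ⊗[R] A, ∃ c, algebraMap E (E ⊗[R] A) c = ∑ g, baseChangeHom ρ E g y := by
      intro y
      induction y with
      | zero => exact ⟨0, by simp⟩
      | tmul e b =>
        obtain ⟨c, hc⟩ := h.exists_trace b
        refine ⟨c • e, ?_⟩
        simp_rw [baseChangeHom_tmul, ← TensorProduct.tmul_sum, ← hc]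
        rw [Algebra.TensorProduct.algebraMap_apply, Algebra.algebraMap_eq_smul_one c]
        simp [TensorProduct.smul_tmul]
      | add y z hy hz =>
        obtain ⟨c, hc⟩ := hy
        obtain ⟨d, hd⟩ := hz
        exact ⟨c + d, by simp_rw [map_add]; rw [hc, hd, Finset.sum_add_distrib]⟩
    obtain ⟨c, hc⟩ := h2 (x * 1 ⊗ₜ a)
    exact ⟨c, by rw [hc, ← h1]⟩
  · obtain ⟨ι, _, u, v, huv⟩ := h.dual
    exact ⟨ι, inferInstance, _, _, huv.map (σ := baseChangeHom ρ E)
      (Algebra.TensorProduct.includeRight : A →ₐ[R] E ⊗[R] A).toRingHom fun g b => rfl⟩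

theorem IsGaloisAction.baseChange {G : Type*} [Group G] [Finite G] {F A : Type*} [Field F]
    [CommRing A] [Algebra F A] {ρ : G →* (A ≃ₐ[F] A)} (h : IsGaloisAction ρ) (E : Type*) [Field E]
    [Algebra F E] : IsGaloisAction (baseChangeHom ρ E) := by
  have := Fintype.ofFinite G
  have := h.nontrivial
  obtain ⟨a, ha⟩ := h.exists_trace_eq_one
  exact h.baseChange_of_trace_eq_one (algebraMap F A).injective ha E

namespace GaloisAlg

theorem baseChangeAct_eq {G : Type v} [Group G] {F : Type u} [Field F]
    (A : GaloisAlg G F) (E : Type u) [Field E] [Algebra F E] (g : G) :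
    A.baseChangeAct E g = baseChangeHom A.act E g := rfl

/-- Every morphism of torsors is an isomorphism after base change, so it suffices to give an
equivariant ring homomorphism over `K → E`. -/
theorem isoOver_iff {G : Type v} [Group G] [Finite G] {F K : Type u} [Field F] [Field K]
    (A : GaloisAlg G F) (B : GaloisAlg G K) (E : Type u) [Field E] [Algebra F E] [Algebra K E] :
    A.IsoOver B E ↔ ∃ f : B.carrier →+* E ⊗[F] A.carrier,
      (∀ c, f (algebraMap K _ c) = algebraMap E _ (algebraMap K E c)) ∧
      ∀ g b, f (B.act g b) = baseChangeHom A.act E g (f b) := by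
  constructor
  · rintro ⟨e, he⟩
    refine ⟨e.symm.toAlgHom.toRingHom.comp
      (Algebra.TensorProduct.includeRight : _ →ₐ[K] E ⊗[K] B.carrier).toRingHom, ?_, ?_⟩
    · intro c
      have : (1 : E) ⊗ₜ[K] algebraMap K B.carrier c = algebraMap E _ (algebraMap K E c) := by
        rw [Algebra.TensorProduct.algebraMap_apply]
        exact (Algebra.TensorProduct.tmul_one_eq_one_tmul c).symm
      change e.symm ((1 : E) ⊗ₜ[K] algebraMap K B.carrier c) = _
      rw [this, AlgEquiv.commutes]
    · intro g b
      change e.symm ((1 : E) ⊗ₜ[K] B.act g b) = A.baseChangeAct E g (e.symm ((1 : E) ⊗ₜ[K] b))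
      rw [AlgEquiv.symm_apply_eq, he, AlgEquiv.apply_symm_apply]
      rfl
  · rintro ⟨f, hf, hfg⟩
    obtain ⟨e, he⟩ :=
      B.isGaloisAction.exists_algEquiv (A.isGaloisAction.baseChange E) f hf hfg
    refine ⟨e.symm, fun g x => ?_⟩
    rw [AlgEquiv.symm_apply_eq]
    obtain ⟨y, rfl⟩ := e.surjective x
    rw [AlgEquiv.symm_apply_apply, baseChangeAct_eq, baseChangeAct_eq, he]

end GaloisAlg

/-! ### Induction from a subgroup -/

section Induction

variable {G : Type*} [Group G] {H : Subgroup G} {K B : Type*} [Field K] [CommRing B] [Algebra K B]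

/-- The algebra induced from an action of a subgroup. -/
def inducedSubalgebra (σ : H →* (B ≃ₐ[K] B)) : Subalgebra K (G → B) where
  carrier := {f | ∀ (h : H) (g : G), f (h * g) = σ h (f g)}
  mul_mem' ha hb h g := by simp [ha h g, hb h g]
  add_mem' ha hb h g := by simp [ha h g, hb h g]
  algebraMap_mem' c h g := by simp

/-- The action by right translations on the induced algebra. -/
def inducedAct (σ : H →* (B ≃ₐ[K] B)) :
    G →* (inducedSubalgebra σ ≃ₐ[K] inducedSubalgebra σ) where
  toFun x :=
    { toFun := fun f => ⟨fun g => f.1 (g * x), fun h g => by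
        simpa only [mul_assoc] using f.2 h _⟩
      invFun := fun f => ⟨fun g => f.1 (g * x⁻¹), fun h g => by
        simpa only [mul_assoc] using f.2 h _⟩
      left_inv := fun f => by ext g; simp
      right_inv := fun f => by ext g; simp
      map_mul' := fun f f' => rfl
      map_add' := fun f f' => rfl
      commutes' := fun c => rfl }
  map_one' := by ext f g; simp
  map_mul' x y := by
    ext f g
    exact congrArg f.1 (mul_assoc g x y).symm

theorem inducedAct_apply (σ : H →* (B ≃ₐ[K] B)) (x : G) (f : inducedSubalgebra σ) (g : G) :
    (inducedAct σ x f).1 g = f.1 (g * x) := rfl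

-- Here `τ g` represents the coset `H g` and `κ g` is the component of `g` in `H`.
variable (H) in
theorem exists_right_transversal : ∃ (τ : G → G) (κ : G → H),
    (∀ g, g = κ g * τ g) ∧ (∀ (h : H) g, τ (h * g) = τ g) ∧ ∀ (h : H) g, κ (h * g) = h * κ g := by
  let τ : G → G := fun g => (Quotient.mk (QuotientGroup.rightRel H) g).out
  have hτ : ∀ g, g * (τ g)⁻¹ ∈ H := fun g => by
    have : QuotientGroup.rightRel H (τ g) g := Quotient.mk_out (s := QuotientGroup.rightRel H) g
    rwa [QuotientGroup.rightRel_apply] at this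
  have hτ' : ∀ (h : H) g, τ (h * g) = τ g := fun h g => by
    have : Quotient.mk (QuotientGroup.rightRel H) (h * g) = Quotient.mk _ g := by
      apply Quotient.sound
      change QuotientGroup.rightRel H _ _
      rw [QuotientGroup.rightRel_apply]
      simp
    simp only [τ, this]
  refine ⟨τ, fun g => ⟨g * (τ g)⁻¹, hτ g⟩, fun g => by simp, hτ', fun h g => ?_⟩
  ext
  simp [hτ', mul_assoc]

theorem IsGaloisAction.induced {G : Type} [Group G] [Finite G] {H : Subgroup G}
    {σ : H →* (B ≃ₐ[K] B)} (hσ : IsGaloisAction σ) : IsGaloisAction (inducedAct σ) := by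
  classical
  have := Fintype.ofFinite G
  have := hσ.nontrivial
  refine ⟨⟨0, 1, fun h => ?_⟩, fun f hf => ?_, ?_⟩
  · exact zero_ne_one (congrFun (congrArg Subtype.val h) 1)
  · have hc : ∀ g, f.1 g = f.1 1 := fun g => by
      conv_rhs => rw [← hf g]
      simp [inducedAct_apply]
    obtain ⟨c, hc'⟩ := hσ.fixed (f.1 1) fun h => by
      have := f.2 h 1
      rw [hc] at this
      exact this.symm
    exact ⟨c, by ext g; rw [hc g, ← hc']; rfl⟩
  · obtain ⟨ι, _, u, v, huv⟩ := hσ.dual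
    obtain ⟨τ, κ, hκ, hτ, hκ'⟩ := exists_right_transversal H
    -- The function `w b t` is supported on the coset of `t` and equals `b` at `t`; it is zero when
    -- `t` is not a chosen representative, so all of `G` may serve as index set.
    let w : B → G → inducedSubalgebra σ := fun b t =>
      ⟨fun x => if τ x = t then σ (κ x) b else 0, fun h g => by
        simp only [hτ, hκ', map_mul, AlgEquiv.mul_apply]
        split_ifs <;> simp⟩
    refine ⟨G × ι, inferInstance, fun p => w (u p.2) p.1, fun p => w (v p.2) p.1, fun g => ?_⟩
    ext x
    have h1 : (∑ p : G × ι, w (u p.2) p.1 * inducedAct σ g (w (v p.2) p.1)).1 x =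
        ∑ t : G, ∑ i, (if τ x = t then σ (κ x) (u i) else 0) *
          (if τ (x * g) = t then σ (κ (x * g)) (v i) else 0) := by
      rw [← Finset.sum_product']
      simp only [AddSubmonoidClass.coe_finsetSum, Finset.sum_apply]
      rfl
    rw [h1, Finset.sum_eq_single (τ x)]
    · by_cases hg : g = 1
      · subst hg
        have := huv 1
        simp only [map_one, AlgEquiv.one_apply, if_true] at this
        simp [← map_mul, ← map_sum, this]
      · rw [if_neg hg]
        simp only [if_true]
        by_cases ht : τ (x * g) = τ x
        · simp only [ht, if_true]
          have h2 : ∀ i, σ (κ x) (u i) * σ (κ (x * g)) (v i) =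
              σ (κ x) (u i * σ ((κ x)⁻¹ * κ (x * g)) (v i)) := fun i => by
            rw [map_mul (σ (κ x)), ← AlgEquiv.mul_apply (σ (κ x)), ← map_mul, mul_inv_cancel_left]
          simp_rw [h2, ← map_sum, huv _]
          rw [if_neg]
          · simp
          · rw [inv_mul_eq_one]
            intro h3
            apply hg
            have h4 := hκ (x * g)
            rw [ht, ← h3, ← hκ x] at h4
            simpa using h4
        · simp [ht]
    · intro t _ ht
      simp [ht.symm]
    · simp

end Induction

/-! ### Descent to an algebraically closed subfield -/

section IntegralClosure

variable {G : Type*} [Group G] {K E C : Type*} [Field K] [Field E] [Algebra K E] [CommRing C]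
  [Algebra E C] [Algebra K C] [IsScalarTower K E C]

variable (K) in
/-- The restriction of an action to the integral closure of a subfield. -/
noncomputable def integralClosureAct (σ : G →* (C ≃ₐ[E] C)) :
    G →* (integralClosure K C ≃ₐ[K] integralClosure K C) where
  toFun g :=
    { toFun := fun x => ⟨σ g x, x.2.map ((σ g).restrictScalars K)⟩
      invFun := fun x => ⟨σ g⁻¹ x, x.2.map ((σ g⁻¹).restrictScalars K)⟩
      left_inv := fun x => by
        ext; change (σ g⁻¹ * σ g) x.1 = x.1; rw [← map_mul]; simp
      right_inv := fun x => by
        ext; change (σ g * σ g⁻¹) x.1 = x.1; rw [← map_mul]; simp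
      map_mul' := fun x y => by ext; simp
      map_add' := fun x y => by ext; simp
      commutes' := fun c => by ext; exact ((σ g).restrictScalars K).commutes c }
  map_one' := by ext x; simp
  map_mul' g h := by ext x; simp

/-- If `K` is algebraically closed in `E`, a Galois algebra over `E` with a dual system integral
over `K` descends to `K`. -/
theorem IsGaloisAction.integralClosure {σ : G →* (C ≃ₐ[E] C)} (hσ : IsGaloisAction σ)
    (hK : ∀ x : E, IsIntegral K x → ∃ y, algebraMap K E y = x) {ι : Type} [Fintype ι] {u v : ι → C}
    (huv : IsDualSystem σ u v) (hu : ∀ i, IsIntegral K (u i)) (hv : ∀ i, IsIntegral K (v i)) :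
    IsGaloisAction (integralClosureAct K σ) := by
  have := hσ.nontrivial
  refine ⟨inferInstance, fun x hx => ?_, ι, inferInstance, fun i => ⟨u i, hu i⟩,
    fun i => ⟨v i, hv i⟩, fun g => ?_⟩
  · obtain ⟨c, hc⟩ := hσ.fixed x.1 fun g => congrArg Subtype.val (hx g)
    have hi : IsIntegral K c := by
      have h1 : IsIntegral K (algebraMap E C c) := by rw [hc]; exact x.2
      rwa [isIntegral_algebraMap_iff (algebraMap E C).injective] at h1
    obtain ⟨y, hy⟩ := hK c hi
    refine ⟨y, ?_⟩
    ext
    rw [← hc, ← hy, ← IsScalarTower.algebraMap_apply]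
    rfl
  · ext
    rw [AddSubmonoidClass.coe_finsetSum]
    refine (huv g).trans ?_
    split_ifs <;> rfl

end IntegralClosure

/-! ### Essential dimension: invariance and subgroups -/

namespace GaloisAlg

theorem essDimAt_le (k : Type u) [Field k] {G : Type v} [Group G] {F : Type u} [Field F]
    [Algebra k F] (A : GaloisAlg G F) (l : ℕ) (E : Type u) [Field E] [Algebra k E] [Algebra F E]
    [IsScalarTower k F E] [FiniteDimensional F E] (hl : ¬ l ∣ Module.finrank F E)
    (K : IntermediateField k E) (B : GaloisAlg G K) (h : A.IsoOver B E) :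
    A.essDimAt k l ≤ Cardinal.toENat (Algebra.trdeg k K) :=
  sInf_le ⟨E, inferInstance, inferInstance, inferInstance, inferInstance, inferInstance, hl, K, B,
    h, rfl⟩

theorem essDimAt_le_essDimAt (k : Type u) [Field k] {G : Type v} [Group G] {F : Type u} [Field F]
    [Algebra k F] (A : GaloisAlg G F) (l : ℕ) : A.essDimAt k l ≤ _root_.essDimAt k G l :=
  le_sSup ⟨F, inferInstance, inferInstance, A, rfl⟩

/-- Transport of a Galois algebra along an isomorphism of groups. -/
def congr {G : Type v} [Group G] {G' : Type*} [Group G'] (e : G ≃* G') {F : Type u} [Field F]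
    (A : GaloisAlg G F) : GaloisAlg G' F where
  carrier := A.carrier
  act := A.act.comp e.symm.toMonoidHom
  nontrivial := A.nontrivial
  bijective := by
    have h : ⇑(galoisMap (A.act.comp e.symm.toMonoidHom)) =
        (Equiv.arrowCongr e.toEquiv (Equiv.refl A.carrier)) ∘ galoisMap A.act := by
      ext t g
      induction t with
      | zero => simp
      | tmul a b => simp [galoisMap_tmul]
      | add x y hx hy =>
        rw [map_add, Pi.add_apply, hx, hy]
        simp
    rw [h]
    exact (Equiv.bijective _).comp A.bijective

theorem essDimAt_le_congr (k : Type u) [Field k] {G : Type v} [Group G] {G' : Type*} [Group G']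
    (e : G ≃* G') {F : Type u} [Field F] [Algebra k F] (A : GaloisAlg G F) (l : ℕ) :
    A.essDimAt k l ≤ (A.congr e).essDimAt k l := by
  refine le_sInf ?_
  rintro m ⟨E, _, _, _, _, _, hl, K, B, ⟨f, hf⟩, rfl⟩
  refine A.essDimAt_le k l E hl K (B.congr e.symm) ⟨f, fun g x => ?_⟩
  have h1 : (A.congr e).baseChangeAct E (e g) x = A.baseChangeAct E g x := by
    change Algebra.TensorProduct.congr _ (A.act (e.symm (e g))) x = _
    rw [e.symm_apply_apply]
    rfl
  rw [← h1]
  exact hf (e g) x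

end GaloisAlg

theorem essDimAt_congr (k : Type u) [Field k] {G : Type v} [Group G] {G' : Type*} [Group G']
    (e : G ≃* G') (l : ℕ) : essDimAt k G l = essDimAt k G' l := by
  apply le_antisymm
  · refine sSup_le ?_
    rintro m ⟨F, _, _, A, rfl⟩
    exact (A.essDimAt_le_congr k e l).trans (GaloisAlg.essDimAt_le_essDimAt k _ l)
  · refine sSup_le ?_
    rintro m ⟨F, _, _, A, rfl⟩
    exact (A.essDimAt_le_congr k e.symm l).trans (GaloisAlg.essDimAt_le_essDimAt k _ l)

theorem IsDualSystem.comp {G H : Type*} [Group G] [Group H] {F A : Type*} [CommRing F] [CommRing A]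
    [Algebra F A] {ρ : G →* (A ≃ₐ[F] A)} {ι : Type*} [Fintype ι] {u v : ι → A}
    (h : IsDualSystem ρ u v) (i : H →* G) (hi : Function.Injective i) :
    IsDualSystem (ρ.comp i) u v := by
  classical
  intro g
  refine (h (i g)).trans ?_
  simp only [map_eq_one_iff i hi]

theorem baseChangeHom_map {G H : Type*} [Group G] [Group H] {F A A' : Type*} [CommRing F]
    [CommRing A] [CommRing A'] [Algebra F A] [Algebra F A'] {ρ : G →* (A ≃ₐ[F] A)}
    {σ : H →* (A' ≃ₐ[F] A')} (E : Type*) [Field E] [Algebra F E] (f : A →ₐ[F] A') {g : G} {h : H}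
    (hf : ∀ a, f (ρ g a) = σ h (f a)) (x : E ⊗[F] A) :
    Algebra.TensorProduct.map (AlgHom.id E E) f (baseChangeHom ρ E g x) =
      baseChangeHom σ E h (Algebra.TensorProduct.map (AlgHom.id E E) f x) := by
  induction x with
  | zero => simp
  | tmul e a => simp [baseChangeHom_tmul, hf]
  | add x y hx hy => simp only [map_add, hx, hy]

/-- A Galois algebra over `E` with a dual system algebraic over a subfield `K` descends to the
algebraic closure of `K` in `E`. -/
theorem GaloisAlg.essDimAt_le_of_dualSystem (k : Type u) [Field k] {G : Type v} [Group G] [Finite G]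
    {F : Type u} [Field F] [Algebra k F] (A : GaloisAlg G F) (l : ℕ) (E : Type u) [Field E]
    [Algebra k E] [Algebra F E] [IsScalarTower k F E] [FiniteDimensional F E]
    (hl : ¬ l ∣ Module.finrank F E) (K : IntermediateField k E) {B : Type*} [CommRing B]
    [Algebra K B] [Algebra.IsIntegral K B] (φ : B →+* E ⊗[F] A.carrier)
    (hφ : ∀ c, φ (algebraMap K B c) = algebraMap E _ (algebraMap K E c)) {ι : Type} [Fintype ι]
    {u v : ι → B} (huv : IsDualSystem (baseChangeHom A.act E) (φ ∘ u) (φ ∘ v)) :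
    A.essDimAt k l ≤ Cardinal.toENat (Algebra.trdeg k K) := by
  -- Replacing `K` by its algebraic closure in `E` keeps the transcendence degree and makes the
  -- invariants of the integral closure equal to the base field.
  obtain ⟨K', hK⟩ : ∃ K' : IntermediateField k E, ∀ x, x ∈ K' ↔ IsAlgebraic K x :=
    ⟨(algebraicClosure K E).restrictScalars k, fun x => mem_algebraicClosure_iff⟩
  have hle : K ≤ K' := fun x hx => (hK x).2 (isAlgebraic_algebraMap (⟨x, hx⟩ : K))
  let _ : Algebra K K' := (IntermediateField.inclusion hle).toAlgebra
  have : IsScalarTower k K K' := IsScalarTower.of_algebraMap_eq fun _ => rfl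
  have : IsScalarTower K K' E := IsScalarTower.of_algebraMap_eq fun _ => rfl
  have : Algebra.IsAlgebraic K K' := ⟨fun x =>
    (isAlgebraic_algebraMap_iff (algebraMap K' E).injective).1 ((hK x).1 x.2)⟩
  have htr : Algebra.trdeg k K' = Algebra.trdeg k K := by
    rw [← trdeg_add_eq k K (A := K'), trdeg_eq_zero (R := K), add_zero]
  rw [← htr]
  have hK' : ∀ x : E, IsIntegral K' x → ∃ y, algebraMap K' E y = x := fun x hx => by
    have h1 : IsAlgebraic K x := (isIntegral_trans (R := K) x hx).isAlgebraic
    exact ⟨⟨x, (hK x).2 h1⟩, rfl⟩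
  have hint : ∀ b, IsIntegral K' (φ b) := fun b => by
    obtain ⟨p, hp, hpb⟩ := Algebra.IsIntegral.isIntegral (R := K) b
    refine ⟨p.map (algebraMap K K'), hp.map _, ?_⟩
    rw [Polynomial.eval₂_map, ← map_zero φ, ← hpb, Polynomial.hom_eval₂]
    congr 1
    ext c
    exact (hφ c).symm
  have hgal := (A.isGaloisAction.baseChange E).integralClosure hK' huv (fun i => hint _)
    (fun i => hint _)
  refine A.essDimAt_le k l E hl K' (GaloisAlg.ofAction _ hgal) ?_
  rw [GaloisAlg.isoOver_iff]
  exact ⟨(integralClosure K' (E ⊗[F] A.carrier)).val.toRingHom, fun c => rfl, fun g b => rfl⟩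

/-- The essential dimension of a subgroup is at most that of the group. -/
theorem essDimAt_subgroup_le (k : Type u) [Field k] {G : Type} [Group G] [Finite G]
    (H : Subgroup G) (l : ℕ) : essDimAt k H l ≤ essDimAt k G l := by
  refine sSup_le ?_
  rintro m ⟨F, _, _, A, rfl⟩
  refine le_trans ?_ (GaloisAlg.essDimAt_le_essDimAt k
    (GaloisAlg.ofAction (inducedAct A.act) A.isGaloisAction.induced) l)
  refine le_sInf ?_
  rintro m ⟨E, _, _, _, _, _, hl, K, B, hiso, rfl⟩
  rw [GaloisAlg.isoOver_iff] at hiso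
  obtain ⟨f, hf, hfg⟩ := hiso
  change B.carrier →+* E ⊗[F] inducedSubalgebra A.act at f
  -- Evaluation at `1` is `H`-equivariant. It carries a dual system of `B` to one for `H` on `E ⊗
  -- A`, although `B` itself need not be an `H`-torsor.
  let ev : inducedSubalgebra A.act →ₐ[F] A.carrier :=
    (Pi.evalAlgHom F (fun _ : G => A.carrier) 1).comp (inducedSubalgebra A.act).val
  have hev : ∀ (h : H) x, ev (inducedAct A.act (h : G) x) = A.act h (ev x) := fun h x => by
    change x.1 (1 * h) = A.act h (x.1 1)
    rw [← x.2 h 1, one_mul, mul_one]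
  let ε : E ⊗[F] inducedSubalgebra A.act →ₐ[E] E ⊗[F] A.carrier :=
    Algebra.TensorProduct.map (AlgHom.id E E) ev
  obtain ⟨ι, _, u, v, huv⟩ := B.isGaloisAction.dual
  have := B.isGaloisAction.finite
  refine A.essDimAt_le_of_dualSystem k l E hl K ((ε : _ →+* _).comp f)
    (fun c => (congrArg ε (hf c)).trans (ε.commutes _)) (u := u) (v := v) ?_
  refine (huv.comp H.subtype H.subtype_injective).map _ fun h b => ?_
  exact (congrArg ε (hfg h b)).trans (baseChangeHom_map E ev (hev h) _)

/-! ### Invariants of a subgroup and reduction of torsors -/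

section FixedSubalgebra

variable {G : Type*} [Group G] {F A : Type*} [CommRing F] [CommRing A] [Algebra F A]
  (ρ : G →* (A ≃ₐ[F] A)) (H : Subgroup G)

/-- The subalgebra of invariants of a subgroup. -/
def fixedSubalgebra : Subalgebra F A where
  carrier := {a | ∀ h ∈ H, ρ h a = a}
  mul_mem' ha hb h hh := by rw [map_mul, ha h hh, hb h hh]
  add_mem' ha hb h hh := by rw [map_add, ha h hh, hb h hh]
  algebraMap_mem' c h _ := by simp

/-- The action of a subgroup, linear over its invariants. -/
def fixedAct : H →* (A ≃ₐ[fixedSubalgebra ρ H] A) where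
  toFun h := { ρ h with commutes' := fun r => r.2 h h.2 }
  map_one' := by ext x; exact congrFun (congrArg DFunLike.coe (map_one ρ)) x
  map_mul' g h := by ext x; exact congrFun (congrArg DFunLike.coe (map_mul ρ (g : G) h)) x

theorem fixedAct_apply (h : H) (a : A) : fixedAct ρ H h a = ρ h a := rfl

variable {ρ}

theorem IsGaloisAction.fixedAct (hρ : IsGaloisAction ρ) : IsGaloisAction (fixedAct ρ H) := by
  refine ⟨hρ.nontrivial, fun a ha => ⟨⟨a, fun h hh => ha ⟨h, hh⟩⟩, rfl⟩, ?_⟩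
  obtain ⟨ι, _, u, v, huv⟩ := hρ.dual
  exact ⟨ι, inferInstance, u, v, huv.comp H.subtype H.subtype_injective⟩

/-- Splitting `G` into right cosets of `H`, the sum of the translates of `a` by coset
representatives has `H`-trace equal to the `G`-trace of `a`. -/
theorem exists_subgroup_trace_eq_one [Fintype G] [Fintype H] {a : A} (ha : ∑ g, ρ g a = 1) :
    ∃ b, ∑ h, _root_.fixedAct ρ H h b = 1 := by
  classical
  obtain ⟨τ, κ, hκ, hτ, hκ'⟩ := exists_right_transversal H
  refine ⟨∑ t ∈ Finset.univ.image τ, ρ t a, ?_⟩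
  simp_rw [map_sum, fixedAct_apply, ← AlgEquiv.mul_apply, ← map_mul]
  rw [← ha, ← Finset.sum_product']
  have hτ0 : ∀ g, τ g = ((κ g)⁻¹ : H) * g := fun g => by
    rw [eq_comm, Subgroup.coe_inv, inv_mul_eq_iff_eq_mul]; exact hκ g
  have hτ1 : ∀ g, τ (τ g) = τ g := fun g => by rw [hτ0 g, hτ, ← hτ0 g]
  have hκ1 : ∀ g, κ (τ g) = 1 := fun g => by rw [hτ0 g, hκ', inv_mul_cancel]
  refine Finset.sum_bij' (fun p _ => (p.1 : G) * p.2) (fun g _ => (κ g, τ g)) (by simp) (by simp)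
    ?_ (fun g _ => (hκ g).symm) (by simp)
  rintro ⟨h, t⟩ ht
  obtain ⟨g, -, rfl⟩ := Finset.mem_image.1 (Finset.mem_product.1 ht).2
  simp [hτ, hτ1, hκ', hκ1]

theorem act_eq_act_of_mem_fixed {r : A} (hr : r ∈ fixedSubalgebra ρ H) {x y : G}
    (hxy : x⁻¹ * y ∈ H) : ρ y r = ρ x r := by
  conv_rhs => rw [← hr _ hxy]
  rw [← AlgEquiv.mul_apply, ← map_mul, mul_inv_cancel_left]

end FixedSubalgebra

/-- Taking `H`-invariants in the second factor of the torsor isomorphism gives `A ⊗ A^H ≅ ∏_{G/H}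
A`; then compare dimensions. -/
theorem IsGaloisAction.finrank_fixedSubalgebra {G : Type v} [Group G] [Finite G] {F A : Type u}
    [Field F] [CommRing A] [Algebra F A] {ρ : G →* (A ≃ₐ[F] A)} (hρ : IsGaloisAction ρ)
    (H : Subgroup G) : Module.finrank F (fixedSubalgebra ρ H) = H.index := by
  classical
  have := Fintype.ofFinite G
  have := Fintype.ofFinite H
  have := Fintype.ofFinite (G ⧸ H)
  have := hρ.nontrivial
  have := hρ.finite
  let Φ : A ⊗[F] fixedSubalgebra ρ H →ₗ[F] (G ⧸ H → A) :=
    TensorProduct.lift (LinearMap.mk₂ F (fun a r q => a * ρ q.out r)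
      (fun a b r => by ext q; simp [add_mul]) (fun c a r => by ext q; simp)
      (fun a r s => by ext q; simp [mul_add]) (fun c a r => by ext q; simp))
  have hΦ : ∀ a r q, Φ (a ⊗ₜ r) q = a * ρ q.out r := fun a r q => rfl
  have hout : ∀ g : G, (g : G ⧸ H).out⁻¹ * g ∈ H := fun g =>
    QuotientGroup.eq.1 (QuotientGroup.out_eq' (g : G ⧸ H))
  have hcomp : ∀ x g, galoisMap ρ ((fixedSubalgebra ρ H).val.toLinearMap.lTensor A x) g =
      Φ x (g : G ⧸ H) := by
    intro x g
    induction x with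
    | zero => simp
    | tmul a r =>
      rw [LinearMap.lTensor_tmul, galoisMap_tmul, hΦ]
      congr 1
      exact act_eq_act_of_mem_fixed H r.2 (hout g)
    | add x y hx hy => rw [map_add, map_add, map_add, Pi.add_apply, Pi.add_apply, hx, hy]
  have hinj : Function.Injective Φ := by
    rw [injective_iff_map_eq_zero]
    intro x hx
    apply Module.Flat.lTensor_preserves_injective_linearMap (M := A)
      (fixedSubalgebra ρ H).val.toLinearMap Subtype.val_injective
    apply hρ.bijective.1
    ext g
    rw [hcomp, hx, map_zero, map_zero]
    rfl
  have hsurj : Function.Surjective Φ := by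
    obtain ⟨ι, _, u, v, huv⟩ := hρ.dual
    intro f
    -- Summing `v i` over `H` turns the dual system into one that detects cosets: `∑ x(u_i) y(t_i)`
    -- is the indicator of `x⁻¹ y ∈ H`.
    let t : ι → fixedSubalgebra ρ H := fun i =>
      ⟨∑ h : H, ρ h (v i), fun h hh => trace_invariant (ρ.comp H.subtype) (v i) ⟨h, hh⟩⟩
    have ht : ∀ x y : G, ∑ i, ρ x (u i) * ρ y (t i) = if x⁻¹ * y ∈ H then 1 else 0 := by
      intro x y
      have h1 : ∀ i, ρ x (u i) * ρ y (t i) =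
          ∑ h : H, ρ x (u i * ρ (x⁻¹ * y * h) (v i)) := by
        intro i
        simp only [t, map_sum, Finset.mul_sum]
        refine Finset.sum_congr rfl fun h _ => ?_
        rw [map_mul (ρ x), ← AlgEquiv.mul_apply (ρ x), ← AlgEquiv.mul_apply (ρ y), ← map_mul,
          ← map_mul]
        congr 3
        group
      simp_rw [h1]
      rw [Finset.sum_comm]
      simp_rw [← map_sum, huv _]
      split_ifs with hxy
      · rw [Finset.sum_eq_single (⟨x⁻¹ * y, hxy⟩⁻¹ : H)]
        · simp
        · intro h _ hh
          rw [if_neg]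
          intro h2
          apply hh
          ext
          exact eq_inv_of_mul_eq_one_right h2
        · simp
      · rw [Finset.sum_eq_zero, map_zero]
        intro h _
        rw [if_neg]
        intro h2
        apply hxy
        rw [mul_eq_one_iff_eq_inv.1 h2]
        exact H.inv_mem h.2
    refine ⟨∑ q, ∑ i, (f q * ρ q.out (u i)) ⊗ₜ t i, ?_⟩
    ext q'
    simp only [map_sum, Finset.sum_apply, hΦ, mul_assoc, ← Finset.mul_sum, ht]
    rw [Finset.sum_eq_single q']
    · simp
    · intro q _ hq
      rw [if_neg, mul_zero]
      rwa [← QuotientGroup.eq, QuotientGroup.out_eq', QuotientGroup.out_eq']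
    · simp
  have h1 := (LinearEquiv.ofBijective Φ ⟨hinj, hsurj⟩).finrank_eq
  rw [Module.finrank_tensorProduct, Module.finrank_pi_fintype] at h1
  simp only [Finset.sum_const, Finset.card_univ, smul_eq_mul] at h1
  rw [mul_comm] at h1
  rw [Nat.eq_of_mul_eq_mul_right Module.finrank_pos h1, Subgroup.index, Nat.card_eq_fintype_card]

/-- A reduced finite-dimensional algebra has a residue field of degree prime to `l` if its
dimension is prime to `l`. -/
theorem exists_maximal_not_dvd_finrank {F R : Type*} [Field F] [CommRing R] [Algebra F R]
    [Module.Finite F R] [IsReduced R] {l : ℕ} (hl : ¬ l ∣ Module.finrank F R) :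
    ∃ m : Ideal R, m.IsMaximal ∧ ¬ l ∣ Module.finrank F (R ⧸ m) := by
  by_contra! hcon
  have : IsArtinianRing R := IsArtinianRing.of_finite F R
  have := Fintype.ofFinite (MaximalSpectrum R)
  apply hl
  rw [((IsArtinianRing.equivPi R).toLinearEquiv.restrictScalars F).finrank_eq,
    Module.finrank_pi_fintype]
  exact Finset.dvd_sum fun m _ => hcon m.asIdeal m.isMaximal

/-- A torsor acquires a reduction to a subgroup of index prime to `l` over an extension of degree
prime to `l`. -/
theorem GaloisAlg.exists_reduction {G : Type v} [Group G] [Finite G] {F : Type u} [Field F]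
    (A : GaloisAlg G F) (H : Subgroup G) {l : ℕ} (hl : ¬ l ∣ H.index) :
    ∃ (F' : Type u) (_ : Field F') (_ : Algebra F F') (_ : FiniteDimensional F F'),
      ¬ l ∣ Module.finrank F F' ∧ ∃ (A' : GaloisAlg H F') (ψ : A.carrier →+* A'.carrier),
        (∀ c, ψ (algebraMap F _ c) = algebraMap F' _ (algebraMap F F' c)) ∧
        ∀ (h : H) a, ψ (A.act h a) = A'.act h (ψ a) := by
  have := Fintype.ofFinite G
  have := Fintype.ofFinite H
  have hA := A.isGaloisAction
  have := hA.finite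
  have := hA.isReduced
  -- Over `R = A^H` the algebra `A` is an `H`-torsor, and the required `A'` is its fibre at a
  -- suitable maximal ideal.
  let R := fixedSubalgebra A.act H
  have : IsReduced R := isReduced_of_injective R.val Subtype.val_injective
  have : Module.Finite F R :=
    Module.Finite.of_injective R.val.toLinearMap Subtype.val_injective
  obtain ⟨m, hm, hlm⟩ := exists_maximal_not_dvd_finrank (F := F) (R := R)
    (by rwa [hA.finrank_fixedSubalgebra])
  let _ : Field (R ⧸ m) := Ideal.Quotient.field m
  obtain ⟨a, ha⟩ := hA.exists_trace_eq_one
  obtain ⟨b, hb⟩ := exists_subgroup_trace_eq_one H ha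
  have hgal := (hA.fixedAct H).baseChange_of_trace_eq_one Subtype.val_injective hb (R ⧸ m)
  have : FiniteDimensional F (R ⧸ m) := inferInstance
  refine ⟨R ⧸ m, inferInstance, inferInstance, this, hlm, GaloisAlg.ofAction _ hgal,
    (Algebra.TensorProduct.includeRight : A.carrier →ₐ[R] (R ⧸ m) ⊗[R] A.carrier).toRingHom,
    fun c => ?_, fun h a => rfl⟩
  change 1 ⊗ₜ[R] algebraMap R A.carrier (algebraMap F R c) = (algebraMap R (R ⧸ m) _) ⊗ₜ[R] 1
  exact (Algebra.TensorProduct.tmul_one_eq_one_tmul _).symm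

/-- The essential `l`-dimension of a group is at most that of a subgroup of index prime to `l`. -/
theorem essDimAt_le_subgroup (k : Type u) [Field k] {G : Type} [Group G] [Finite G]
    (H : Subgroup G) {l : ℕ} (hprime : l.Prime) (hl : ¬ l ∣ H.index) :
    essDimAt k G l ≤ essDimAt k H l := by
  refine sSup_le ?_
  rintro m ⟨F, _, _, A, rfl⟩
  obtain ⟨F', _, _, _, hlF, A', ψ, hψ, hψH⟩ := A.exists_reduction H hl
  let _ : Algebra k F' := ((algebraMap F F').comp (algebraMap k F)).toAlgebra
  have : IsScalarTower k F F' := IsScalarTower.of_algebraMap_eq fun _ => rfl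
  refine le_trans ?_ (A'.essDimAt_le_essDimAt k l)
  refine le_sInf ?_
  rintro m ⟨E, _, _, _, _, _, hlE, K, B, hiso, rfl⟩
  rw [GaloisAlg.isoOver_iff] at hiso
  obtain ⟨f, hf, hfH⟩ := hiso
  let _ : Algebra F E := ((algebraMap F' E).comp (algebraMap F F')).toAlgebra
  have : IsScalarTower F F' E := IsScalarTower.of_algebraMap_eq fun _ => rfl
  have : IsScalarTower k F E := IsScalarTower.of_algebraMap_eq fun c =>
    IsScalarTower.algebraMap_apply k F' E c
  have : FiniteDimensional F E := FiniteDimensional.trans F F' E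
  refine A.essDimAt_le k l E ?_ K (GaloisAlg.ofAction _ B.isGaloisAction.induced) ?_
  · rw [← Module.finrank_mul_finrank F F' E, hprime.dvd_mul]
    tauto
  rw [GaloisAlg.isoOver_iff]
  have hC := (A'.isGaloisAction.baseChange E).induced
  let σ := baseChangeHom A'.act E
  let i : A'.carrier →+* E ⊗[F'] A'.carrier :=
    (Algebra.TensorProduct.includeRight : _ →ₐ[F'] E ⊗[F'] A'.carrier).toRingHom
  -- Frobenius reciprocity: `ψ` extends to `a ↦ (g ↦ ψ (g a))`, which identifies `E ⊗ A` with the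
  -- algebra induced from `E ⊗ A'`.
  let Θ : A.carrier →+* inducedSubalgebra σ :=
    { toFun := fun a => ⟨fun g => i (ψ (A.act g a)), fun h g => by
        change i (ψ (A.act (h * g) a)) = σ h (i (ψ (A.act g a)))
        rw [map_mul, AlgEquiv.mul_apply, hψH]
        rfl⟩
      map_one' := by ext; simp
      map_mul' := fun a b => by ext; simp
      map_zero' := by ext; simp
      map_add' := fun a b => by ext; simp }
  obtain ⟨e, he⟩ := A.isGaloisAction.exists_algEquiv hC (E := E) Θ
    (fun c => by
      ext g
      change i (ψ (A.act g (algebraMap F _ c))) = algebraMap E _ (algebraMap F E c)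
      rw [AlgEquiv.commutes, hψ]
      change (1 : E) ⊗ₜ[F'] (algebraMap F' _ (algebraMap F F' c)) =
        (algebraMap F' E (algebraMap F F' c)) ⊗ₜ[F'] 1
      exact (Algebra.TensorProduct.tmul_one_eq_one_tmul _).symm)
    (fun x a => by
      ext g
      change i (ψ (A.act g (A.act x a))) = i (ψ (A.act (g * x) a))
      rw [map_mul, AlgEquiv.mul_apply])
  let fI : inducedSubalgebra B.act →+* inducedSubalgebra σ :=
    { toFun := fun b => ⟨fun g => f (b.1 g), fun h g => by
        change f (b.1 (h * g)) = σ h (f (b.1 g))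
        rw [b.2 h g, hfH]⟩
      map_one' := by ext; simp
      map_mul' := fun a b => by ext; simp
      map_zero' := by ext; simp
      map_add' := fun a b => by ext; simp }
  refine ⟨e.symm.toAlgHom.toRingHom.comp fI, fun c => ?_, fun g b => ?_⟩
  · change e.symm (fI (algebraMap K _ c)) = _
    rw [AlgEquiv.symm_apply_eq, AlgEquiv.commutes]
    ext g
    exact hf c
  · change e.symm (fI (inducedAct B.act g b)) = baseChangeHom A.act E g (e.symm (fI b))
    rw [AlgEquiv.symm_apply_eq, ← he, AlgEquiv.apply_symm_apply]
    rfl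

theorem essDimAt_eq_of_injective (k : Type u) [Field k] {G H : Type*} [Group G] [Finite G] [Group H]
    (i : H →* G) (hi : Function.Injective i) {l : ℕ} (hprime : l.Prime)
    (hl : ¬ l ∣ i.range.index) : essDimAt k H l = essDimAt k G l := by
  -- Dual systems are indexed in `Type`, and the one on an induced algebra has index set `G × ι`, so
  -- `G` is first moved to `Type`.
  let e : Shrink.{0} G ≃* G := Shrink.mulEquiv
  let j : H →* Shrink.{0} G := e.symm.toMonoidHom.comp i
  have hj : Function.Injective j := e.symm.injective.comp hi
  have : Finite (Shrink.{0} G) := Finite.of_equiv G e.symm.toEquiv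
  have hindex : j.range.index = i.range.index := by
    rw [MonoidHom.range_comp]
    exact Subgroup.index_map_equiv i.range e.symm
  rw [essDimAt_congr k (MonoidHom.ofInjective hj), ← essDimAt_congr k e]
  exact le_antisymm (essDimAt_subgroup_le k _ l)
    (essDimAt_le_subgroup k _ hprime (by rwa [hindex]))

/-- The essential `l`-dimension does not change under division by a normal subgroup of order prime
to `l`. -/
theorem essDimAt_quotient_eq (k : Type u) [Field k] {G : Type v} [Group G] [Finite G]
    (Z : Subgroup G) [Z.Normal] {l : ℕ} (hprime : l.Prime) (hZ : ¬ l ∣ Nat.card Z) :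
    essDimAt k (G ⧸ Z) l = essDimAt k G l := by
  have : Fact l.Prime := ⟨hprime⟩
  obtain ⟨P⟩ : Nonempty (Sylow l G) := inferInstance
  have hP : ¬ l ∣ (P : Subgroup G).index := P.not_dvd_index
  rw [← essDimAt_eq_of_injective k (P : Subgroup G).subtype (Subgroup.subtype_injective _) hprime
    (by rwa [Subgroup.range_subtype])]
  refine (essDimAt_eq_of_injective k ((QuotientGroup.mk' Z).comp (P : Subgroup G).subtype) ?_ hprime
    ?_).symm
  -- An element of `P ∩ Z` has order a power of `l` that divides `|Z|`, hence order one.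
  · rw [injective_iff_map_eq_one]
    intro x hx
    have hxZ : (x : G) ∈ Z := (QuotientGroup.eq_one_iff _).1 hx
    have h1 : orderOf (x : G) ∣ Nat.card Z := Subgroup.orderOf_dvd_natCard Z hxZ
    obtain ⟨m, hm⟩ := P.isPGroup'.exists_card_eq
    have h2 : orderOf (x : G) ∣ l ^ m := hm ▸ Subgroup.orderOf_dvd_natCard _ x.2
    have h3 : Nat.Coprime (l ^ m) (Nat.card Z) :=
      Nat.Coprime.pow_left m ((Nat.Prime.coprime_iff_not_dvd hprime).2 hZ)
    have h4 : orderOf (x : G) = 1 := Nat.eq_one_of_dvd_coprimes h3 h2 h1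
    ext
    exact orderOf_eq_one_iff.1 h4
  · rw [MonoidHom.range_comp, Subgroup.range_subtype]
    exact fun h => hP (h.trans (Subgroup.index_map_dvd _ (QuotientGroup.mk'_surjective Z)))

/-! ### Counting hyperbolic systems -/

section SymplecticCounting

variable {𝔽 : Type*} [Field 𝔽] {V : Type*} [AddCommGroup V] [Module 𝔽 V]

/-- A system of `j` mutually orthogonal hyperbolic pairs. -/
def IsHyperbolic (ω : LinearMap.BilinForm 𝔽 V) {j : ℕ} (t : Fin j → V × V) : Prop :=
  (∀ a b, ω (t a).1 (t b).1 = 0) ∧ (∀ a b, ω (t a).2 (t b).2 = 0) ∧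
    ∀ a b, ω (t a).1 (t b).2 = if a = b then 1 else 0

/-- The orthogonal complement of a system of pairs of vectors. -/
def pairsOrthogonal (ω : LinearMap.BilinForm 𝔽 V) {j : ℕ} (t : Fin j → V × V) : Submodule 𝔽 V :=
  LinearMap.ker ((LinearMap.pi fun a => ω (t a).1).prod (LinearMap.pi fun a => ω (t a).2))

theorem mem_pairsOrthogonal {ω : LinearMap.BilinForm 𝔽 V} {j : ℕ} {t : Fin j → V × V} {v : V} :
    v ∈ pairsOrthogonal ω t ↔ ∀ a, ω (t a).1 v = 0 ∧ ω (t a).2 v = 0 := by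
  simp [pairsOrthogonal, funext_iff, forall_and]

theorem IsHyperbolic.finrank_orthogonal [Module.Finite 𝔽 V] {ω : LinearMap.BilinForm 𝔽 V}
    (hω : ω.IsAlt) {j : ℕ} {t : Fin j → V × V} (ht : IsHyperbolic ω t) :
    Module.finrank 𝔽 (pairsOrthogonal ω t) + 2 * j = Module.finrank 𝔽 V := by
  obtain ⟨h1, h2, h3⟩ := ht
  have h4 : ∀ a b, ω (t a).2 (t b).1 = - if a = b then 1 else 0 := fun a b => by
    rw [← hω.neg_eq, h3]; simp only [eq_comm]
  let Φ : V →ₗ[𝔽] (Fin j → 𝔽) × (Fin j → 𝔽) :=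
    (LinearMap.pi fun a => ω (t a).1).prod (LinearMap.pi fun a => ω (t a).2)
  have hsurj : Function.Surjective Φ := by
    rintro ⟨c, d⟩
    -- Pairing with the hyperbolic vectors reads off the coefficients, so any prescribed values are
    -- attained.
    refine ⟨∑ a, (c a • (t a).2 - d a • (t a).1), ?_⟩
    ext b
    · simp [Φ, h1, h3]
    · simp [Φ, h2, h4]
  have h5 := Φ.finrank_range_add_finrank_ker
  rw [LinearMap.range_eq_top.2 hsurj, finrank_top, Module.finrank_prod] at h5
  simp only [Module.finrank_fin_fun] at h5
  change _ + Module.finrank 𝔽 (pairsOrthogonal ω t) = _ at h5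
  omega

theorem IsHyperbolic.exists_apply_ne_zero {ω : LinearMap.BilinForm 𝔽 V} (hω : ω.IsAlt)
    (hnd : ∀ x, (∀ y, ω x y = 0) → x = 0) {j : ℕ} {t : Fin j → V × V} (ht : IsHyperbolic ω t)
    {e : V} (he : e ∈ pairsOrthogonal ω t) (he0 : e ≠ 0) :
    ∃ f ∈ pairsOrthogonal ω t, ω e f ≠ 0 := by
  by_contra! hcon
  apply he0
  apply hnd
  intro v
  obtain ⟨h1, h2, h3⟩ := ht
  have h4 : ∀ a b, ω (t a).2 (t b).1 = - if a = b then 1 else 0 := fun a b => by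
    rw [← hω.neg_eq, h3]; simp only [eq_comm]
  rw [mem_pairsOrthogonal] at he
  have he1 : ∀ a, ω e (t a).1 = 0 := fun a => by rw [← hω.neg_eq, (he a).1, neg_zero]
  have he2 : ∀ a, ω e (t a).2 = 0 := fun a => by rw [← hω.neg_eq, (he a).2, neg_zero]
  -- The argument is the projection of `v` to the orthogonal complement; `e` pairs with it as with
  -- `v`.
  have h5 := hcon (v - ∑ a, (ω v (t a).2 • (t a).1 - ω v (t a).1 • (t a).2)) <| by
    rw [mem_pairsOrthogonal]
    intro b
    constructor
    · simp [h1, h3, ← hω.neg_eq v]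
    · simp [h2, h4, ← hω.neg_eq v]
  simpa [he1, he2] using h5

theorem card_fiber_linearMap {W : Type*} [AddCommGroup W] [Module 𝔽 W] [Module.Finite 𝔽 W]
    {φ : W →ₗ[𝔽] 𝔽} (hφ : φ ≠ 0) (c : 𝔽) :
    Nat.card {w // φ w = c} = Nat.card 𝔽 ^ (Module.finrank 𝔽 W - 1) := by
  have hsurj : Function.Surjective φ := LinearMap.surjective hφ
  obtain ⟨w₀, hw₀⟩ := hsurj c
  have h1 : Nat.card {w // φ w = c} = Nat.card (LinearMap.ker φ) := by
    refine Nat.card_congr ((Equiv.subRight w₀).subtypeEquiv fun w => ?_)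
    simp [hw₀, sub_eq_zero]
  have h5 := φ.finrank_range_add_finrank_ker
  rw [LinearMap.range_eq_top.2 hsurj, finrank_top, Module.finrank_self] at h5
  rw [h1, Module.natCard_eq_pow_finrank (K := 𝔽), ← h5]
  simp

theorem card_hyperbolic_pairs {W : Type*} [AddCommGroup W] [Module 𝔽 W] [Module.Finite 𝔽 W]
    [Finite 𝔽] (ω : W →ₗ[𝔽] W →ₗ[𝔽] 𝔽) (hω : ∀ e, e ≠ 0 → ω e ≠ 0) :
    Nat.card {p : W × W // ω p.1 p.2 = 1} =
      (Nat.card 𝔽 ^ Module.finrank 𝔽 W - 1) * Nat.card 𝔽 ^ (Module.finrank 𝔽 W - 1) := by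
  classical
  have : Finite W := Module.finite_of_finite 𝔽
  have := Fintype.ofFinite W
  let E : {p : W × W // ω p.1 p.2 = 1} ≃ Σ e : W, {f : W // ω e f = 1} :=
    { toFun := fun p => ⟨p.1.1, p.1.2, p.2⟩
      invFun := fun p => ⟨(p.1, p.2.1), p.2.2⟩
      left_inv := fun _ => rfl
      right_inv := fun _ => rfl }
  rw [Nat.card_congr E, Nat.card_sigma, ← Finset.add_sum_erase _ _ (Finset.mem_univ (0 : W)),
    Finset.sum_congr rfl fun e he =>
      card_fiber_linearMap (hω e (Finset.ne_of_mem_erase he)) 1]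
  have h0 : Nat.card {f : W // ω 0 f = 1} = 0 := by
    have : IsEmpty {f : W // ω 0 f = 1} := ⟨fun f => by simpa using f.2⟩
    exact Nat.card_of_isEmpty
  rw [h0, zero_add, Finset.sum_const, Finset.card_erase_of_mem (Finset.mem_univ _),
    Finset.card_univ, ← Nat.card_eq_fintype_card, Module.natCard_eq_pow_finrank (K := 𝔽), smul_eq_mul]

theorem isHyperbolic_cons {ω : LinearMap.BilinForm 𝔽 V} (hω : ω.IsAlt) {j : ℕ} (p : V × V)
    (t : Fin j → V × V) : IsHyperbolic ω (Fin.cons p t : Fin (j + 1) → V × V) ↔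
      IsHyperbolic ω t ∧ p.1 ∈ pairsOrthogonal ω t ∧ p.2 ∈ pairsOrthogonal ω t ∧ ω p.1 p.2 = 1 := by
  have hs : ∀ x y, ω x y = 0 ↔ ω y x = 0 := fun x y => by rw [← hω.neg_eq, neg_eq_zero]
  simp only [IsHyperbolic, Fin.forall_fin_succ, Fin.cons_zero, Fin.cons_succ, hω.self_eq_zero,
    mem_pairsOrthogonal, Fin.succ_inj, forall_and, (Fin.succ_ne_zero _).symm, Fin.succ_ne_zero,
    if_true, if_false, hs p.1, hs p.2]
  tauto

/-- Each new pair is chosen in the complement of the previous ones, where the form is again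
nondegenerate, of dimension smaller by `2` per pair. Truncated subtraction is harmless: once the
complement is zero, the factor `q^0 - 1` vanishes. -/
theorem card_isHyperbolic [Finite 𝔽] [Module.Finite 𝔽 V] {ω : LinearMap.BilinForm 𝔽 V} (hω : ω.IsAlt)
    (hnd : ∀ x, (∀ y, ω x y = 0) → x = 0) (j : ℕ) :
    Nat.card {t : Fin j → V × V // IsHyperbolic ω t} =
      ∏ i ∈ Finset.range j, (Nat.card 𝔽 ^ (Module.finrank 𝔽 V - 2 * i) - 1) *
        Nat.card 𝔽 ^ (Module.finrank 𝔽 V - 2 * i - 1) := by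
  classical
  have : Finite V := Module.finite_of_finite 𝔽
  induction j with
  | zero =>
    have : Unique {t : Fin 0 → V × V // IsHyperbolic ω t} :=
      { default := ⟨Fin.elim0, by simp [IsHyperbolic]⟩
        uniq := fun t => Subtype.ext (Subsingleton.elim _ _) }
    simp
  | succ j ih =>
    have := Fintype.ofFinite {t : Fin j → V × V // IsHyperbolic ω t}
    let E : {t : Fin (j + 1) → V × V // IsHyperbolic ω t} ≃
        Σ t : {t : Fin j → V × V // IsHyperbolic ω t},
          {p : pairsOrthogonal ω t.1 × pairsOrthogonal ω t.1 // ω p.1 p.2 = 1} :=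
      { toFun := fun t => by
          have h := (isHyperbolic_cons hω (t.1 0) (Fin.tail t.1)).1 (by
            rw [Fin.cons_self_tail]; exact t.2)
          exact ⟨⟨Fin.tail t.1, h.1⟩, ⟨(⟨(t.1 0).1, h.2.1⟩, ⟨(t.1 0).2, h.2.2.1⟩), h.2.2.2⟩⟩
        invFun := fun s => ⟨Fin.cons (s.2.1.1.1, s.2.1.2.1) s.1.1,
          (isHyperbolic_cons hω _ _).2 ⟨s.1.2, s.2.1.1.2, s.2.1.2.2, s.2.2⟩⟩
        left_inv := fun t => Subtype.ext (Fin.cons_self_tail t.1)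
        right_inv := fun s => rfl }
    rw [Nat.card_congr E, Nat.card_sigma, Finset.prod_range_succ, ← ih]
    have hc : ∀ t : {t : Fin j → V × V // IsHyperbolic ω t},
        Nat.card {p : pairsOrthogonal ω t.1 × pairsOrthogonal ω t.1 //
          ω (p.1 : V) (p.2 : V) = 1} =
        (Nat.card 𝔽 ^ (Module.finrank 𝔽 V - 2 * j) - 1) *
          Nat.card 𝔽 ^ (Module.finrank 𝔽 V - 2 * j - 1) := by
      intro t
      have h1 := card_hyperbolic_pairs (𝔽 := 𝔽) (W := pairsOrthogonal ω t.1)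
        (ω.domRestrict₁₂ _ _) (fun e he hz => by
          obtain ⟨f, hf, hef⟩ := t.2.exists_apply_ne_zero hω hnd e.2 (by simpa using he)
          exact hef (congrFun (congrArg DFunLike.coe hz) ⟨f, hf⟩))
      have h2 := t.2.finrank_orthogonal hω
      rw [show Module.finrank 𝔽 V - 2 * j = Module.finrank 𝔽 (pairsOrthogonal ω t.1) by omega, ← h1]
      rfl
    rw [Finset.sum_congr rfl fun t _ => hc t, Finset.sum_const, Finset.card_univ,
      ← Nat.card_eq_fintype_card, smul_eq_mul]

end SymplecticCounting

/-! ### Orders of the symplectic and general linear groups -/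

section SymplecticOrder

variable (n : ℕ) (𝔽 : Type v) [Field 𝔽]

/-- The standard symplectic form. -/
noncomputable def symplecticForm : LinearMap.BilinForm 𝔽 (Fin n ⊕ Fin n → 𝔽) :=
  Matrix.toBilin' (Matrix.J (Fin n) 𝔽)

variable {n 𝔽}

theorem symplecticForm_apply (x y : Fin n ⊕ Fin n → 𝔽) :
    symplecticForm n 𝔽 x y =
      ∑ i, (x (Sum.inr i) * y (Sum.inl i) - x (Sum.inl i) * y (Sum.inr i)) := by
  simp [symplecticForm, Matrix.toBilin'_apply', Matrix.J, dotProduct, Matrix.mulVec,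
    Fintype.sum_sum_type, Matrix.one_apply, Finset.sum_add_distrib, sub_eq_neg_add]

theorem symplecticForm_isAlt : (symplecticForm n 𝔽).IsAlt := by
  intro x
  rw [symplecticForm_apply]
  exact Finset.sum_eq_zero fun i _ => by ring

theorem symplecticForm_nondegenerate (x : Fin n ⊕ Fin n → 𝔽)
    (hx : ∀ y, symplecticForm n 𝔽 x y = 0) : x = 0 := by
  ext i
  rcases i with i | i
  · simpa [symplecticForm_apply, Pi.single_apply] using hx (Pi.single (Sum.inr i) 1)
  · simpa [symplecticForm_apply, Pi.single_apply] using hx (Pi.single (Sum.inl i) 1)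

theorem mem_symplecticGroup_iff_form (A : Matrix (Fin n ⊕ Fin n) (Fin n ⊕ Fin n) 𝔽) :
    A ∈ Matrix.symplecticGroup (Fin n) 𝔽 ↔
      ∀ i j, symplecticForm n 𝔽 (A i) (A j) = Matrix.J (Fin n) 𝔽 i j := by
  rw [SymplecticGroup.mem_iff, ← Matrix.ext_iff]
  refine forall_congr' fun i => forall_congr' fun j => ?_
  rw [symplecticForm, Matrix.toBilin'_apply', Matrix.mul_assoc, Matrix.mul_apply']
  rfl

/-- The condition `A J Aᵀ = J` prescribes the pairings of the rows. The lower row comes first in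
each pair because `J` has `1` in its lower left block. -/
theorem mem_symplecticGroup_iff_isHyperbolic (A : Matrix (Fin n ⊕ Fin n) (Fin n ⊕ Fin n) 𝔽) :
    A ∈ Matrix.symplecticGroup (Fin n) 𝔽 ↔
      IsHyperbolic (symplecticForm n 𝔽) fun a => (A (Sum.inr a), A (Sum.inl a)) := by
  have hω := symplecticForm_isAlt (n := n) (𝔽 := 𝔽)
  rw [mem_symplecticGroup_iff_form]
  constructor
  · intro h
    exact ⟨fun a b => by simp [h, Matrix.J], fun a b => by simp [h, Matrix.J],
      fun a b => by simp [h, Matrix.J, Matrix.one_apply]⟩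
  · rintro ⟨h1, h2, h3⟩ (i | i) (j | j)
    · simp [h2, Matrix.J]
    · rw [← hω.neg_eq, h3]
      simp [Matrix.J, Matrix.one_apply, eq_comm]
    · simp [h3, Matrix.J, Matrix.one_apply]
    · simp [h1, Matrix.J]

/-- The order of the symplectic group over a finite field, up to a power of `q`. -/
theorem exists_card_Sp [Finite 𝔽] : ∃ b, Nat.card (Sp n 𝔽) =
    Nat.card 𝔽 ^ b * ∏ i ∈ Finset.range n, (Nat.card 𝔽 ^ (2 * (i + 1)) - 1) := by
  let E : Sp n 𝔽 ≃
      {t : Fin n → (Fin n ⊕ Fin n → 𝔽) × (Fin n ⊕ Fin n → 𝔽) //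
        IsHyperbolic (symplecticForm n 𝔽) t} :=
    { toFun := fun A => ⟨_, (mem_symplecticGroup_iff_isHyperbolic A.1).1 A.2⟩
      invFun := fun t => ⟨fun i => Sum.elim (fun a => (t.1 a).2) (fun a => (t.1 a).1) i,
        (mem_symplecticGroup_iff_isHyperbolic _).2 t.2⟩
      left_inv := fun A => by
        ext i j
        rcases i with i | i <;> rfl
      right_inv := fun t => rfl }
  rw [Nat.card_congr E, card_isHyperbolic symplecticForm_isAlt symplecticForm_nondegenerate,
    Finset.prod_mul_distrib, Finset.prod_pow_eq_pow_sum, mul_comm]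
  refine ⟨_, congrArg _ ?_⟩
  rw [← Finset.prod_range_reflect]
  refine Finset.prod_congr rfl fun i hi => ?_
  have := Finset.mem_range.1 hi
  rw [Module.finrank_fintype_fun_eq_card, Fintype.card_sum, Fintype.card_fin]
  congr 2
  omega

theorem exists_card_GL [Finite 𝔽] : ∃ b, Nat.card (Matrix.GeneralLinearGroup (Fin n) 𝔽) =
    Nat.card 𝔽 ^ b * ∏ i ∈ Finset.range n, (Nat.card 𝔽 ^ (i + 1) - 1) := by
  have := Fintype.ofFinite 𝔽
  refine ⟨∑ i ∈ Finset.range n, i, ?_⟩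
  rw [Matrix.card_GL_field, ← Finset.prod_range_reflect (fun i => _ - 1),
    ← Finset.prod_pow_eq_pow_sum, ← Finset.prod_mul_distrib, Nat.card_eq_fintype_card,
    ← Fin.prod_univ_eq_prod_range (fun i => _ ^ i * _)]
  refine Finset.prod_congr rfl fun i _ => ?_
  rw [Nat.mul_sub, mul_one, ← pow_add]
  congr 2
  omega

end SymplecticOrder

/-! ### Embeddings and the centre -/

section Embeddings

variable (n : ℕ) (𝔽 : Type v) [Field 𝔽]

/-- The inclusion of the symplectic group in the general linear group. -/
noncomputable def spToGL : Sp n 𝔽 →* Matrix.GeneralLinearGroup (Fin (2 * n)) 𝔽 :=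
  MonoidHom.toHomUnits <|
    (Matrix.reindexAlgEquiv 𝔽 𝔽 (finSumFinEquiv.trans (finCongr (two_mul n).symm))
      : Matrix (Fin n ⊕ Fin n) (Fin n ⊕ Fin n) 𝔽 →* _).comp
      (Matrix.symplecticGroup (Fin n) 𝔽).subtype

theorem spToGL_injective : Function.Injective (spToGL n 𝔽) := by
  intro A B h
  have h1 := congrArg Units.val h
  exact Subtype.ext ((Matrix.reindexAlgEquiv 𝔽 𝔽 _).injective h1)

/-- The Levi subgroup `GL_n` of the symplectic group, stabilizing a pair of transversal
Lagrangians. -/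
noncomputable def glToSp : Matrix.GeneralLinearGroup (Fin n) 𝔽 →* Sp n 𝔽 where
  toFun A := ⟨Matrix.fromBlocks A.1 0 0 (A⁻¹).1.transpose, by
    rw [SymplecticGroup.mem_iff, Matrix.J, Matrix.fromBlocks_transpose, Matrix.fromBlocks_multiply,
      Matrix.fromBlocks_multiply]
    simp [← Matrix.transpose_mul]⟩
  map_one' := by ext1; simp
  map_mul' A B := by
    ext1
    simp [Matrix.fromBlocks_multiply, Matrix.transpose_mul]

theorem glToSp_injective : Function.Injective (glToSp n 𝔽) := by
  intro A B h
  have h1 := congrArg (fun M : Sp n 𝔽 => M.1.toBlocks₁₁) h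
  exact Units.ext (by simpa [glToSp] using h1)

variable {n 𝔽}

theorem mem_symplecticGroup_of_isSymm {S : Matrix (Fin n) (Fin n) 𝔽} (hS : S.transpose = S) :
    Matrix.fromBlocks 1 S 0 1 ∈ Matrix.symplecticGroup (Fin n) 𝔽 := by
  rw [SymplecticGroup.mem_iff, Matrix.J, Matrix.fromBlocks_transpose, Matrix.fromBlocks_multiply,
    Matrix.fromBlocks_multiply]
  simp [hS]

/-- Commuting with `J` and with the unipotent block of `S = 1` forces `z = diag(d, d)`; the blocks
`S = E_jj` make `d` diagonal. Then `d` is symmetric, and the symplectic condition `d dᵀ = 1` reads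
`d² = 1`. -/
theorem sq_eq_one_of_mem_center_Sp {z : Sp n 𝔽} (hz : z ∈ Subgroup.center (Sp n 𝔽)) :
    z ^ 2 = 1 := by
  rw [Subgroup.mem_center_iff] at hz
  obtain ⟨a, b, c, d, hzb⟩ : ∃ a b c d, z.1 = Matrix.fromBlocks a b c d :=
    ⟨_, _, _, _, (Matrix.fromBlocks_toBlocks z.1).symm⟩
  have hcomm : ∀ S : Matrix (Fin n) (Fin n) 𝔽, S.transpose = S →
      Matrix.fromBlocks 1 S 0 1 * Matrix.fromBlocks a b c d =
        Matrix.fromBlocks a b c d * Matrix.fromBlocks 1 S 0 1 := fun S hS => by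
    rw [← hzb]
    exact congrArg Subtype.val (hz ⟨_, mem_symplecticGroup_of_isSymm hS⟩)
  have hJ := congrArg Subtype.val (hz (SymplecticGroup.symJ (Fin n) 𝔽))
  simp only [Matrix.fromBlocks_multiply, Matrix.fromBlocks_inj] at hcomm
  have h1 := hcomm 1 Matrix.transpose_one
  simp at h1
  obtain ⟨hc, had, -⟩ := h1
  change Matrix.J _ _ * z.1 = z.1 * Matrix.J _ _ at hJ
  rw [hzb, Matrix.J, Matrix.fromBlocks_multiply, Matrix.fromBlocks_multiply,
    Matrix.fromBlocks_inj] at hJ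
  simp at hJ
  subst hc
  have hb : b = 0 := by simpa using hJ.1.symm
  have hda : d = a := by simpa [hb] using had
  subst hb hda
  have hdiag : ∀ i j, i ≠ j → d i j = 0 := fun i j hij => by
    have h2 := (hcomm (Matrix.single j j 1) (by simp)).2.1
    have h3 := congrFun (congrFun h2 i) j
    simpa [Matrix.single_mul_apply_of_ne, hij] using h3.symm
  have hsymm : d.transpose = d := by
    ext i j
    by_cases hij : i = j
    · rw [hij, Matrix.transpose_apply]
    · rw [Matrix.transpose_apply, hdiag i j hij, hdiag j i (Ne.symm hij)]
  have hz2 := z.2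
  rw [SymplecticGroup.mem_iff, hzb, Matrix.J, Matrix.fromBlocks_transpose,
    Matrix.fromBlocks_multiply, Matrix.fromBlocks_multiply, Matrix.fromBlocks_inj] at hz2
  have hdd : d * d = 1 := by simpa [hsymm] using hz2.2.2.1
  ext1
  change z.1 ^ 2 = 1
  rw [pow_two, hzb, Matrix.fromBlocks_multiply]
  simp [hdd]

theorem not_dvd_card_center_Sp [Finite 𝔽] {l : ℕ} (hl : l.Prime) (hl2 : l ≠ 2) :
    ¬ l ∣ Nat.card (Subgroup.center (Sp n 𝔽)) := by
  intro h
  have : Fact l.Prime := ⟨hl⟩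
  obtain ⟨z, hz⟩ := exists_prime_orderOf_dvd_card' l h
  have h1 : z ^ 2 = 1 := Subtype.ext (sq_eq_one_of_mem_center_Sp z.2)
  rw [← orderOf_dvd_iff_pow_eq_one, hz] at h1
  exact hl2 ((Nat.prime_dvd_prime_iff_eq hl Nat.prime_two).1 h1)

theorem index_range_mul_card {G H : Type*} [Group G] [Group H] (i : H →* G)
    (hi : Function.Injective i) : i.range.index * Nat.card H = Nat.card G := by
  rw [Nat.card_congr (MonoidHom.ofInjective hi).toEquiv, mul_comm, Subgroup.card_mul_index]

end Embeddings

/-! ### Divisibility of the indices -/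

section Arithmetic

/-- The number `d` is the multiplicative order of `q` modulo `l`. -/
theorem dvd_pow_sub_one_iff {l q d : ℕ} (hq : 0 < q)
    (hd : IsLeast {m : ℕ | 0 < m ∧ l ∣ q ^ m - 1} d) (m : ℕ) : l ∣ q ^ m - 1 ↔ d ∣ m := by
  have key : ∀ m, l ∣ q ^ m - 1 ↔ (q : ZMod l) ^ m = 1 := fun m => by
    rw [← ZMod.natCast_eq_zero_iff, Nat.cast_sub (Nat.one_le_pow _ _ hq), sub_eq_zero]
    simp
  have h1 : orderOf (q : ZMod l) = d := by
    have h2 : orderOf (q : ZMod l) ∣ d := orderOf_dvd_of_pow_eq_one ((key d).1 hd.1.2)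
    exact le_antisymm (Nat.le_of_dvd hd.1.1 h2)
      (hd.2 ⟨Nat.pos_of_dvd_of_pos h2 hd.1.1, (key _).2 (pow_orderOf_eq_one _)⟩)
  rw [key, ← orderOf_dvd_iff_pow_eq_one, h1]

theorem prod_range_two_mul (f : ℕ → ℕ) (n : ℕ) : ∏ i ∈ Finset.range (2 * n), f (i + 1) =
    (∏ i ∈ Finset.range n, f (2 * (i + 1))) * ∏ i ∈ Finset.range n, f (2 * i + 1) := by
  induction n with
  | zero => simp
  | succ n ih =>
    rw [show 2 * (n + 1) = 2 * n + 1 + 1 by ring, Finset.prod_range_succ, Finset.prod_range_succ, ih,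
      Finset.prod_range_succ, Finset.prod_range_succ]
    ring_nf

end Arithmetic

/-- The even-exponent factors of `|GL_{2n}|` cancel against `|Sp|`, and an even `d` divides none of
the odd exponents that remain. -/
theorem not_dvd_index_spToGL {l n d : ℕ} (hl : l.Prime) {𝔽 : Type v} [Field 𝔽] [Finite 𝔽]
    (hlq : ¬ l ∣ Nat.card 𝔽) (hd : IsLeast {m : ℕ | 0 < m ∧ l ∣ Nat.card 𝔽 ^ m - 1} d)
    (heven : Even d) : ¬ l ∣ (spToGL n 𝔽).range.index := by
  have hq : 1 < Nat.card 𝔽 := Finite.one_lt_card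
  obtain ⟨b, hb⟩ := exists_card_Sp (n := n) (𝔽 := 𝔽)
  obtain ⟨a, ha⟩ := exists_card_GL (n := 2 * n) (𝔽 := 𝔽)
  have h := index_range_mul_card _ (spToGL_injective n 𝔽)
  rw [ha, hb, prod_range_two_mul (fun i => Nat.card 𝔽 ^ i - 1)] at h
  set P := ∏ i ∈ Finset.range n, (Nat.card 𝔽 ^ (2 * (i + 1)) - 1)
  have hP : 0 < P := Finset.prod_pos fun i _ => Nat.sub_pos_of_lt (Nat.one_lt_pow (by omega) hq)
  have h2 : (spToGL n 𝔽).range.index * Nat.card 𝔽 ^ b =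
      Nat.card 𝔽 ^ a * ∏ i ∈ Finset.range n, (Nat.card 𝔽 ^ (2 * i + 1) - 1) :=
    Nat.eq_of_mul_eq_mul_right hP (by rw [mul_assoc, h]; ring)
  intro hdvd
  have h3 := h2 ▸ hdvd.mul_right (Nat.card 𝔽 ^ b)
  rcases hl.dvd_mul.1 h3 with h4 | h4
  · exact hlq (hl.dvd_of_dvd_pow h4)
  · obtain ⟨i, -, hi⟩ := (Prime.dvd_finsetProd_iff hl.prime _).1 h4
    rw [dvd_pow_sub_one_iff (by omega) hd] at hi
    have := (even_iff_two_dvd.1 heven).trans hi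
    omega

theorem not_dvd_index_glToSp {l n d : ℕ} (hl : l.Prime) (hl2 : l ≠ 2) {𝔽 : Type v} [Field 𝔽]
    [Finite 𝔽] (hlq : ¬ l ∣ Nat.card 𝔽)
    (hd : IsLeast {m : ℕ | 0 < m ∧ l ∣ Nat.card 𝔽 ^ m - 1} d)
    (hodd : Odd d) : ¬ l ∣ (glToSp n 𝔽).range.index := by
  have hq : 1 < Nat.card 𝔽 := Finite.one_lt_card
  obtain ⟨b, hb⟩ := exists_card_Sp (n := n) (𝔽 := 𝔽)
  obtain ⟨a, ha⟩ := exists_card_GL (n := n) (𝔽 := 𝔽)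
  have h := index_range_mul_card _ (glToSp_injective n 𝔽)
  have hfac : ∀ i, Nat.card 𝔽 ^ (2 * i) - 1 = (Nat.card 𝔽 ^ i + 1) * (Nat.card 𝔽 ^ i - 1) :=
    fun i => by rw [mul_comm 2, pow_mul]; exact Nat.sq_sub_sq _ 1
  simp only [ha, hb, hfac, Finset.prod_mul_distrib] at h
  set P := ∏ i ∈ Finset.range n, (Nat.card 𝔽 ^ (i + 1) - 1)
  have hP : 0 < P := Finset.prod_pos fun i _ => Nat.sub_pos_of_lt (Nat.one_lt_pow (by omega) hq)
  have h2 : (glToSp n 𝔽).range.index * Nat.card 𝔽 ^ a =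
      Nat.card 𝔽 ^ b * ∏ i ∈ Finset.range n, (Nat.card 𝔽 ^ (i + 1) + 1) :=
    Nat.eq_of_mul_eq_mul_right hP (by rw [mul_assoc, h]; ring)
  intro hdvd
  have h3 := h2 ▸ hdvd.mul_right (Nat.card 𝔽 ^ a)
  rcases hl.dvd_mul.1 h3 with h4 | h4
  · exact hlq (hl.dvd_of_dvd_pow h4)
  · obtain ⟨i, -, hi⟩ := (Prime.dvd_finsetProd_iff hl.prime _).1 h4
    have h5 : d ∣ 2 * (i + 1) := by
      rw [← dvd_pow_sub_one_iff (by omega) hd, hfac]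
      exact hi.mul_right _
    -- Since `d` is odd, `l` divides `q^(i+1) - 1` as well as `q^(i+1) + 1`, hence their difference
    -- `2`.
    have h6 : d ∣ i + 1 :=
      (Nat.coprime_two_right.2 hodd).dvd_of_dvd_mul_left h5
    rw [← dvd_pow_sub_one_iff (by omega) hd] at h6
    have h7 := (Nat.dvd_sub hi h6)
    have h8 : 0 < Nat.card 𝔽 ^ (i + 1) := by positivity
    rw [show Nat.card 𝔽 ^ (i + 1) + 1 - (Nat.card 𝔽 ^ (i + 1) - 1) = 2 by omega] at h7
    exact hl2 ((Nat.prime_dvd_prime_iff_eq hl Nat.prime_two).1 h7)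

theorem theorem7p1 (p r l n d : ℕ) (hp : p.Prime) (hl : l.Prime) (hl2 : l ≠ 2) (hlp : l ≠ p)
    (𝔽 : Type v) [Field 𝔽] [Finite 𝔽] (hq : Nat.card 𝔽 = p ^ r)
    (k : Type u) [Field k] (hk : ringChar k ≠ l)
    (hd : IsLeast {m : ℕ | 0 < m ∧ l ∣ (p ^ r) ^ m - 1} d) :
    essDimAt k (PSp n 𝔽) l = essDimAt k (Sp n 𝔽) l ∧
      essDimAt k (Sp n 𝔽) l =
        if Even d then essDimAt k (Matrix.GeneralLinearGroup (Fin (2 * n)) 𝔽) l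
        else essDimAt k (Matrix.GeneralLinearGroup (Fin n) 𝔽) l := by
  rw [← hq] at hd
  have hlq : ¬ l ∣ Nat.card 𝔽 := fun h =>
    hlp ((Nat.prime_dvd_prime_iff_eq hl hp).1 (hl.dvd_of_dvd_pow (hq ▸ h)))
  refine ⟨essDimAt_quotient_eq k _ hl (not_dvd_card_center_Sp hl hl2), ?_⟩
  split_ifs with h
  · exact essDimAt_eq_of_injective k _ (spToGL_injective n 𝔽) hl (not_dvd_index_spToGL hl hlq hd h)
  · exact (essDimAt_eq_of_injective k _ (glToSp_injective n 𝔽) hl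
      (not_dvd_index_glToSp hl hl2 hlq hd (Nat.not_even_iff_odd.1 h))).symm
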